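/- Let $\Omega=\{\Omega_1,\dots,\Omega_m\}$ be a multi-region configuration in $\mathbb R^{n+1}$: compact connected regions with boundaries and corners which meet only along unions of boundary strata, their boundaries being locally, where several regions meet, of the standard type $P_k$ or $Q_k$. Let $\{(M_i,U_i,\ell_i)\}$ be an (unbounded) skeletal linking structure for it. Here $(M_i,U_i)$ is a skeletal structure for $\Omega_i$: a compact Whitney stratified set $M_i$ of dimension $n$ with a multivalued radial vector field $U_i=r_i\mathbf u_i$ ($r_i=\|U_i\|>0$), whose radial flow $x+tU_i$, $0<t\le 1$, fills $\Omega_i\setminus M_i$ bijectively and stratawise nonsingularly and reaches $\partial\Omega_i$ at $t=1$. The linking functions $\ell_i\ge r_i$ are continuous, and smooth on the strata of a refined stratification of the double $\tilde M_i=\{(x,U): x\in M_i,\ U \text{ a value of } U_i \text{ at } x\}$, except that $\ell_i=\infty$ on the union $M_{i,\infty}$ of the unlinked strata. The linking flow, which runs from $x$ along $\mathbf u_i$ to $x+\ell_i\mathbf u_i$, is nonsingular on strata, the flow lines from different points of the doubles meet only at their ends, and these ends form a stratified set. The radial flow from $\bigcup_i M_{i,\infty}$, for all $t>0$, is injective and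 nonsingular on strata and has as image the complement of the image of the linking flow. Let $S_{rad}(v)=-\mathrm{proj}_U(\partial\mathbf u/\partial v)$ be the radial shape operator on $T_xM_i$ ($\mathrm{proj}_U$ is the projection onto $T_xM_i$ along $U$), defined at the points of $\tilde M_i$ over the regular ($n$-dimensional) strata of $M_i$. Let $dM$ be the Borel measure on $\tilde M=\coprod_i\tilde M_i$ which is $\rho\,dV$ over the regular strata and zero on the singular strata, where $dV$ is the $n$-dimensional Riemannian volume and $\rho=\mathbf u_i\cdot\mathbf n$ with $\mathbf n$ the unit normal on the side of $U_i$; thus $\int_{\tilde M}h\,dM=\sum_i\int_{\tilde M_i}h\,dM_i$. (1) Let $g:\mathbb R^{n+1}\to\mathbb R$ be Borel measurable and Lebesgue integrable, with compact support. For $(x,U)\in\tilde M_i$ put $$\tilde g(x)=\int_0^{\ell_i} g(x+t\mathbf u_i)\det(I-tS_{rad})\,dt .$$ Then $\tilde g$ is defined (the integral exists) almost everywhere on $\tilde M$, it is integrable on $\tilde M$, and $$\int_{\mathbb R^{n+1}} g\,dV=\int_{\tilde M}\tilde g\,dM .$$ (2) (Interior and exterior decomposition.) For $g$ as in (1), the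 functions $$\tilde g_{int}(x)=\int_0^{r_i} g(x+t\mathbf u_i)\det(I-tS_{rad})\,dt,\qquad \tilde g_{ext}(x)=\int_{r_i}^{\ell_i} g(x+t\mathbf u_i)\det(I-tS_{rad})\,dt$$ are defined almost everywhere and integrable on $\tilde M$, and $$\int_{\mathbb R^{n+1}} g\,dV=\int_{\tilde M}\tilde g_{int}\,dM+\int_{\tilde M}\tilde g_{ext}\,dM .$$ (3) (Crofton type formula.) For every compact $Q\subset\mathbb R^{n+1}$ the function $$m_Q(x)=\int_0^{\ell_i}\chi_Q(x+t\mathbf u_i)\det(I-tS_{rad})\,dt$$ is defined almost everywhere and integrable on $\tilde M$, and $\mathrm{vol}(Q)=\int_{\tilde M}m_Q\,dM$. -/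

import Mathlib

open Set Filter Topology MeasureTheory
open scoped ENNReal ContDiff

namespace SkeletalLinking

/-- Euclidean space of dimension `d`. -/
abbrev Euc (d : ℕ) : Type := EuclideanSpace ℝ (Fin d)

/-- Pairs `(x, U)` consisting of a point of `ℝ^{n+1}` and a vector at that point. -/
abbrev PV (n : ℕ) : Type := Euc (n + 1) × Euc (n + 1)

section Geometry

variable {F G : Type*} [NormedAddCommGroup F] [NormedSpace ℝ F]
  [NormedAddCommGroup G] [NormedSpace ℝ G]

/-- Near `x`, the set `A` looks like the set `B` near `0`: some local `C^r` diffeomorphism `e` of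
the ambient spaces, defined near `x` and with `e x = 0`, carries `A` to `B`. -/
def LocallyModelled (r : WithTop ℕ∞) (A : Set F) (x : F) (B : Set G) : Prop :=
  ∃ e : OpenPartialHomeomorph F G, x ∈ e.source ∧ e x = 0 ∧
    ContDiffOn ℝ r e e.source ∧ ContDiffOn ℝ r e.symm e.target ∧
    ∀ y ∈ e.source, (y ∈ A ↔ e y ∈ B)

/-- `A` is an embedded `C^∞` submanifold (without boundary) of dimension `k`. -/
def IsSmoothSubmanifold (k : ℕ) (A : Set F) : Prop :=
  ∀ x ∈ A, ∃ V : Submodule ℝ F, Module.finrank ℝ V = k ∧ LocallyModelled ∞ A x (V : Set F)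

/-- The linear span of the tangent cone of `A` at `x`.  For a submanifold, with or without
boundary and corners, this is the tangent space at `x`. -/
def tangentSpan (A : Set F) (x : F) : Submodule ℝ F :=
  Submodule.span ℝ (tangentConeAt ℝ A x)

/-- A finite stratification of `A`: a decomposition into connected embedded smooth submanifolds,
with the frontier condition. -/
structure IsStratification (𝒮 : Set (Set F)) (A : Set F) : Prop where
  finite : 𝒮.Finite
  sUnion_eq : ⋃₀ 𝒮 = A
  disjoint : ∀ S ∈ 𝒮, ∀ T ∈ 𝒮, S ≠ T → Disjoint S T
  connected : ∀ S ∈ 𝒮, IsConnected S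
  smooth : ∀ S ∈ 𝒮, ∃ k, IsSmoothSubmanifold k S
  frontier_condition : ∀ S ∈ 𝒮, ∀ T ∈ 𝒮, (S ∩ closure T).Nonempty → S ⊆ closure T

end Geometry

/-! ### Multi-region configurations -/

section Configurations

/-- The model `ℝ^k_+ × ℝ^{d-k}` of a manifold with boundaries and corners. -/
def orthant (d k : ℕ) : Set (Euc d) := {y | ∀ i : Fin d, (i : ℕ) < k → 0 ≤ y i}

/-- `x` is a `k`-edge-corner point of the region `A`. -/
def IsEdgeCornerPoint {n : ℕ} (A : Set (Euc (n + 1))) (k : ℕ) (x : Euc (n + 1)) : Prop :=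
  1 ≤ k ∧ k ≤ n + 1 ∧ LocallyModelled ∞ A x (orthant (n + 1) k)

/-- The hyperplane `L_k = {y ∈ ℝ^{k+1} : ∑ y_i = 0}`. -/
def hyperplaneL (k : ℕ) : Submodule ℝ (Euc (k + 1)) where
  carrier := {y | ∑ i, y i = 0}
  add_mem' := by
    intro a b ha hb
    simp only [mem_ofPred_eq, PiLp.add_apply, Finset.sum_add_distrib] at *
    simp [ha, hb]
  zero_mem' := by simp
  smul_mem' := by
    intro c a ha
    simp only [mem_ofPred_eq, PiLp.smul_apply, smul_eq_mul, ← Finset.mul_sum] at *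
    simp [ha]

/-- `P_k = Y_k × ℝ^d`, where `Y_k ⊆ L_k` is the set of `y` whose smallest coordinate occurs at
least twice. -/
def modelP (k d : ℕ) : Set (hyperplaneL k × Euc d) :=
  {p | ∃ i j : Fin (k + 1), i ≠ j ∧
    (p.1 : Euc (k + 1)) i = (p.1 : Euc (k + 1)) j ∧
    ∀ l, (p.1 : Euc (k + 1)) i ≤ (p.1 : Euc (k + 1)) l}

/-- `Q_k = Z ∪ (H ∩ P_k)`, where `Z` is the hyperplane on which the last coordinate vanishes and
`H` is the half-space on which it is nonnegative. -/
def modelQ (k d : ℕ) : Set (hyperplaneL k × Euc (d + 1)) :=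
  {p | p.2 (Fin.last d) = 0} ∪ ({p | 0 ≤ p.2 (Fin.last d)} ∩ modelP k (d + 1))

/-- Multi-region configurations `Ω_1, …, Ω_m` in `ℝ^{n+1}`: compact connected regions with
boundaries and corners, satisfying the boundary intersection condition (two regions meet only along
their boundaries, in a union of boundary strata, which is the closure of its open
strata, where both boundaries are smooth and coincide) and the boundary edge condition (where
several regions meet, their boundaries are locally of type `P_k` or `Q_k`). -/
structure IsMultiRegionConfiguration {n m : ℕ} (Ω : Fin m → Set (Euc (n + 1))) : Prop where
  compact : ∀ i, IsCompact (Ω i)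
  connected : ∀ i, IsConnected (Ω i)
  corners : ∀ i, ∀ x ∈ frontier (Ω i), ∃ k, IsEdgeCornerPoint (Ω i) k x
  inter_subset : ∀ i j, i ≠ j → Ω i ∩ Ω j ⊆ frontier (Ω i) ∩ frontier (Ω j)
  inter_strata : ∀ i j, i ≠ j → Ω i ∩ Ω j ⊆
    closure {y ∈ Ω i ∩ Ω j | IsEdgeCornerPoint (Ω i) 1 y ∧ IsEdgeCornerPoint (Ω j) 1 y ∧
      frontier (Ω i) =ᶠ[𝓝 y] frontier (Ω j)}
  edge : ∀ i j, i ≠ j → ∀ x ∈ Ω i ∩ Ω j,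
    (∃ k d, 1 ≤ k ∧ k + d = n + 1 ∧
      LocallyModelled ∞ (⋃ l ∈ {l | x ∈ Ω l}, frontier (Ω l)) x (modelP k d)) ∨
    (∃ k d, 1 ≤ k ∧ k + (d + 1) = n + 1 ∧
      LocallyModelled ∞ (⋃ l ∈ {l | x ∈ Ω l}, frontier (Ω l)) x (modelQ k d))

end Configurations

/-! ### Skeletal structures -/

section Skeletal

/-- Whitney's conditions (a) and (b) for the pair of strata `(Y, X)` at points of `X`.
Convergence of linear subspaces is convergence of the orthogonal projections. -/
def WhitneyRegular {d : ℕ} (Y X : Set (Euc d)) : Prop :=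
  ∀ x ∈ X, ∀ (y : ℕ → Euc d) (τ : Submodule ℝ (Euc d)), (∀ k, y k ∈ Y) →
    Tendsto y atTop (𝓝 x) →
    Tendsto (fun k => (tangentSpan Y (y k)).starProjection) atTop (𝓝 τ.starProjection) →
    tangentSpan X x ≤ τ ∧
    ∀ (a : ℕ → Euc d) (v : Euc d), (∀ k, a k ∈ X) → (∀ k, a k ≠ y k) →
      Tendsto a atTop (𝓝 x) →
      Tendsto (fun k => ‖a k - y k‖⁻¹ • (a k - y k)) atTop (𝓝 v) → v ∈ τ

/-- A Whitney stratification of `A`. -/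
structure IsWhitneyStratification {d : ℕ} (𝒮 : Set (Set (Euc d))) (A : Set (Euc d)) : Prop
    extends IsStratification 𝒮 A where
  whitney : ∀ Y ∈ 𝒮, ∀ X ∈ 𝒮, X ≠ Y → WhitneyRegular Y X

/-- The union `M_reg` of the `n`-dimensional strata. -/
def regularPart (n : ℕ) (𝒮 : Set (Set (Euc (n + 1)))) : Set (Euc (n + 1)) :=
  ⋃₀ {X ∈ 𝒮 | IsSmoothSubmanifold n X}

/-- The model of an `n`-manifold with boundaries and corners inside `ℝ^{n+1}`. -/
def sheetModel (n k : ℕ) : Set (Euc (n + 1)) :=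
  {y | y (Fin.last n) = 0 ∧ ∀ i : Fin (n + 1), (i : ℕ) < k → 0 ≤ y i}

/-- `x` is a `k`-edge-corner point of the sheet `P`, a hypersurface with boundaries and
corners.  (Sheets of a skeletal set are smooth along strata, but may be only `C^1` up to their
boundaries.) -/
def IsSheetPoint {n : ℕ} (P : Set (Euc (n + 1))) (k : ℕ) (x : Euc (n + 1)) : Prop :=
  k ≤ n ∧ LocallyModelled 1 P x (sheetModel n k)

/-- The set `∂M` of edge points, where `M` is locally a hypersurface with boundary and `x` is a
boundary point. -/
def edgePoints {n : ℕ} (M : Set (Euc (n + 1))) : Set (Euc (n + 1)) :=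
  {x ∈ M | IsSheetPoint M 1 x}

/-- A paving of `M` in the open set `O`: the part of `M` in `O` is a finite union of relatively
closed `n`-manifolds with boundaries and corners, two of which meet only on their
boundaries; those which meet `∂M` do so in `(n-1)`-dimensional faces; and both values of
the multivalued vector field `U` extend from the regular part over each of them, continuously and
smoothly along the strata of `M`. -/
structure IsPaving {n N : ℕ} (M : Set (Euc (n + 1))) (𝒮 : Set (Set (Euc (n + 1))))
    (U : Euc (n + 1) → Set (Euc (n + 1))) (O : Set (Euc (n + 1)))
    (P : Fin N → Set (Euc (n + 1))) (V : Fin N → Fin 2 → Euc (n + 1) → Euc (n + 1)) : Prop where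
  union : M ∩ O = ⋃ j, P j
  relClosed : ∀ j, ∃ K, IsClosed K ∧ P j = K ∩ O
  corners : ∀ j, ∀ x ∈ P j, ∃ k, IsSheetPoint (P j) k x
  meet : ∀ i j, i ≠ j → ∀ x ∈ P i ∩ P j, ¬ IsSheetPoint (P i) 0 x
  edge : ∀ j, P j ∩ edgePoints M ⊆ closure {x ∈ P j ∩ edgePoints M | IsSheetPoint (P j) 1 x}
  field_mem : ∀ j a, ∀ x ∈ P j, V j a x ∈ U x
  field_eq : ∀ j, ∀ x ∈ P j ∩ regularPart n 𝒮, U x = {V j 0 x, V j 1 x}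
  field_continuous : ∀ j a, ContinuousOn (V j a) (P j)
  field_smooth : ∀ j a, ∀ X ∈ 𝒮, ContDiffOn ℝ ∞ (V j a) (P j ∩ X)

/-- The vector `v` at `x` points into `C`. -/
def PointsInto {d : ℕ} (C : Set (Euc d)) (x v : Euc d) : Prop :=
  ∀ᶠ t in 𝓝[>] (0 : ℝ), x + t • v ∈ C

/-- The double of `M`: all pairs `(x, U)` with `x ∈ M` and `U` a value at `x` of the multivalued
vector field. -/
def doubleOf {n : ℕ} (M : Set (Euc (n + 1))) (U : Euc (n + 1) → Set (Euc (n + 1))) :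
    Set (PV n) := {z | z.1 ∈ M ∧ z.2 ∈ U z.1}

/-- A skeletal structure `(M, U)` in `ℝ^{n+1}`: a compact Whitney stratified set `M` of dimension
`n` and a multivalued vector field `U` on `M`. -/
structure SkeletalStructure (n : ℕ) where
  /-- The skeletal set. -/
  M : Set (Euc (n + 1))
  /-- Its strata. -/
  strata : Set (Set (Euc (n + 1)))
  /-- The set of values of the radial vector field at a point. -/
  U : Euc (n + 1) → Set (Euc (n + 1))
  compact : IsCompact M
  whitney : IsWhitneyStratification strata M
  dim_le : ∀ X ∈ strata, ∃ k ≤ n, IsSmoothSubmanifold k X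
  /-- The regular strata are open in `M`. -/
  regular_open : ∀ X ∈ strata, IsSmoothSubmanifold n X → ∃ O, IsOpen O ∧ M ∩ O = X
  U_nonempty : ∀ x ∈ M, (U x).Nonempty
  U_finite : ∀ x ∈ M, (U x).Finite
  U_ne_zero : ∀ x ∈ M, (0 : Euc (n + 1)) ∉ U x
  /-- At a regular point there are two values of `U`, pointing to opposite sides of `M`, and the
  values on either side form a smooth vector field. -/
  U_regular : ∀ x₀ ∈ regularPart n strata, ∃ O, IsOpen O ∧ x₀ ∈ O ∧
    ∃ V₁ V₂ : Euc (n + 1) → Euc (n + 1),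
      ContDiffOn ℝ ∞ V₁ (M ∩ O) ∧ ContDiffOn ℝ ∞ V₂ (M ∩ O) ∧
      ∀ x ∈ M ∩ O, U x = {V₁ x, V₂ x} ∧
        ∀ ν ∈ (tangentSpan M x)ᗮ, ν ≠ 0 → inner ℝ (V₁ x) ν * inner ℝ (V₂ x) ν < 0
  /-- Unique limiting tangent spaces along local components of the regular part at singular
  points. -/
  limit_tangent : ∀ x₀ ∈ M \ regularPart n strata, ∃ O, IsOpen O ∧ x₀ ∈ O ∧
    ∀ x ∈ regularPart n strata ∩ O,
      x₀ ∈ closure (connectedComponentIn (regularPart n strata ∩ O) x) →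
      ∃ τ : Submodule ℝ (Euc (n + 1)), Tendsto (fun y => (tangentSpan M y).starProjection)
        (𝓝[connectedComponentIn (regularPart n strata ∩ O) x] x₀) (𝓝 τ.starProjection)
  /-- Singular points have paved neighborhoods, and `U` is transverse to those sheets through the
  point that do not meet the edge `∂M` near it. -/
  paved : ∀ x₀ ∈ M \ regularPart n strata, ∃ O, IsOpen O ∧ x₀ ∈ O ∧
    ∃ (N : ℕ) (P : Fin N → Set (Euc (n + 1)))
      (V : Fin N → Fin 2 → Euc (n + 1) → Euc (n + 1)),
      IsPaving M strata U O P V ∧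
      ∀ j, x₀ ∈ P j → x₀ ∉ closure (P j ∩ edgePoints M) →
        ∀ a, V j a x₀ ∉ tangentSpan (P j) x₀
  /-- Near a singular point away from the edges, exactly one value of `U` at the point points into
  each local complementary component `C`, and the values pointing into `C` form a continuous vector
  field, smooth on strata. -/
  U_complement : ∀ x₀ ∈ M \ regularPart n strata, x₀ ∉ closure (edgePoints M) →
    ∃ ε₀ > 0, ∀ ε, 0 < ε → ε < ε₀ → ∀ c ∈ Metric.ball x₀ ε \ M,
      let C := connectedComponentIn (Metric.ball x₀ ε \ M) c
      let D := {x ∈ M ∩ Metric.ball x₀ ε | ∃ v ∈ U x, PointsInto C x v}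
      x₀ ∈ closure C →
        (∃! v, v ∈ U x₀ ∧ PointsInto C x₀ v) ∧
        ∃ V : Euc (n + 1) → Euc (n + 1), ContinuousOn V D ∧
          (∀ X ∈ strata, ContDiffOn ℝ ∞ V (D ∩ X)) ∧
          ∀ x ∈ D, ∀ v ∈ U x, PointsInto C x v → v = V x
  /-- At an edge point `U` has a unique value, which is tangent to `M` and points away from
  `M`. -/
  U_edge : ∀ x₀ ∈ edgePoints M, ∃ v, U x₀ = {v} ∧ v ∈ tangentSpan M x₀ ∧
    v ∉ posTangentConeAt M x₀

/-- A map `f` on (a set of pairs) `× ℝ` is nonsingular on `S × I`: in smooth immersed coordinates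
on `S`, it is smooth and its derivative is injective at all points of `S × I`. -/
def NonsingularOn {n : ℕ} (f : PV n → ℝ → Euc (n + 1)) (S : Set (PV n)) (I : Set ℝ) : Prop :=
  ∀ (k : ℕ) (W : Set (Euc k)) (φ : Euc k → PV n), IsOpen W → ContDiffOn ℝ ∞ φ W →
    MapsTo φ W S → (∀ w ∈ W, Function.Injective (fderiv ℝ φ w)) →
    ContDiffOn ℝ ∞ (fun p : Euc k × ℝ => f (φ p.1) p.2) (W ×ˢ univ) ∧
    ∀ w ∈ W, ∀ t ∈ I,
      Function.Injective (fderiv ℝ (fun p : Euc k × ℝ => f (φ p.1) p.2) (w, t))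

/-- The radial flow `ψ_t (x, U) = x + t U`. -/
def radialFlow {n : ℕ} (z : PV n) (t : ℝ) : Euc (n + 1) := z.1 + t • z.2

/-- The radial function `r = ‖U‖`. -/
noncomputable def radius {n : ℕ} (z : PV n) : ℝ := ‖z.2‖

/-- The unit vector field `u`, with `U = r u`. -/
noncomputable def unitField {n : ℕ} (z : PV n) : Euc (n + 1) := ‖z.2‖⁻¹ • z.2

namespace SkeletalStructure

variable {n : ℕ} (K : SkeletalStructure n)

/-- The double `M̃`. -/
def double : Set (PV n) := doubleOf K.M K.U

/-- The part `M̃_reg` of the double over the regular part of `M`. -/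
def regularDouble : Set (PV n) := {z ∈ K.double | z.1 ∈ regularPart n K.strata}

/-- `(M, U)` is a skeletal structure for the region `Ω`: the radial flow is a bijection from
`M̃ × (0,1]` to `Ω \ M`, nonsingular along each stratum, and at time one it maps onto the
boundary of `Ω`. -/
structure IsSkeletalStructureFor (Ω : Set (Euc (n + 1))) : Prop where
  subset : K.M ⊆ Ω
  bijOn : BijOn (fun p : PV n × ℝ => radialFlow p.1 p.2) (K.double ×ˢ Ioc 0 1) (Ω \ K.M)
  boundary : (fun z : PV n => radialFlow z 1) '' K.double = frontier Ω
  nonsingular : ∀ X ∈ K.strata,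
    NonsingularOn radialFlow {z ∈ K.double | z.1 ∈ X} (Ioc 0 1)

/-- `S` is the radial shape operator `S v = - proj_U (∂u/∂v)` on `T_x M` at the
point `z = (x, U)` of the double, where `proj_U` is the projection to `T_x M` along `U`.  The
derivative of `u` along `v` is taken for the smooth value of `u` through `z`, that is, along the
unique tangent vector `(v, w)` of the double over `v`. -/
def IsRadialShapeOperator (z : PV n)
    (S : tangentSpan K.M z.1 →ₗ[ℝ] tangentSpan K.M z.1) : Prop :=
  ∀ (v : tangentSpan K.M z.1) (w : Euc (n + 1)),
    ((v : Euc (n + 1)), w) ∈ tangentSpan K.double z →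
    ∃ c : ℝ, fderiv ℝ unitField z ((v : Euc (n + 1)), w) = -(S v : Euc (n + 1)) + c • z.2

/-- The radial shape operator `S_rad` at a (regular) point of the double. -/
noncomputable def radialShape (z : PV n) : tangentSpan K.M z.1 →ₗ[ℝ] tangentSpan K.M z.1 :=
  Classical.epsilon (K.IsRadialShapeOperator z)

/-- `det (I - t S_rad)`. -/
noncomputable def shapeDet (z : PV n) (t : ℝ) : ℝ :=
  LinearMap.det (LinearMap.id - t • K.radialShape z)

/-- The unit normal to `M` pointing to the same side as `U`. -/
noncomputable def unitNormal (z : PV n) : Euc (n + 1) :=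
  ‖(tangentSpan K.M z.1)ᗮ.starProjection z.2‖⁻¹ • (tangentSpan K.M z.1)ᗮ.starProjection z.2

/-- The density `ρ = u · n`. -/
noncomputable def rho (z : PV n) : ℝ := inner ℝ (unitField z) (K.unitNormal z)

/-- A smooth local parametrization, on `W ⊆ ℝ^n`, of the regular part of the double, lying over an
immersion into `M`. -/
structure IsParametrization (W : Set (Euc n)) (φ : Euc n → PV n) : Prop where
  isOpen : IsOpen W
  smooth : ContDiffOn ℝ ∞ φ W
  injOn : InjOn φ W
  mapsTo : MapsTo φ W K.regularDouble
  immersion : ∀ w ∈ W, Function.Injective (fderiv ℝ (fun w => (φ w).1) w)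

/-- The Riemannian volume density of the parametrized hypersurface `w ↦ (φ w).1`. -/
noncomputable def volumeDensity (φ : Euc n → PV n) (w : Euc n) : ℝ :=
  √(Matrix.gram ℝ (fun j : Fin n =>
    fderiv ℝ (fun w => (φ w).1) w (EuclideanSpace.single j 1))).det

/-- The measure `ρ dV` in a parametrization of the regular part of the double. -/
noncomputable def localMeasure (W : Set (Euc n)) (φ : Euc n → PV n) : Measure (PV n) :=
  ((volume.restrict W).withDensity
    (fun w => ENNReal.ofReal (K.rho (φ w) * volumeDensity φ w))).map φ

/-- The skeletal measure `dM` on the double `M̃`.  It is obtained by gluing the measures `ρ dV`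
given in local parametrizations of `M̃_reg` (which agree on overlaps), as the smallest measure
that dominates all of them; the singular strata have measure zero. -/
noncomputable def skeletalMeasure : Measure (PV n) :=
  ⨆ (W : Set (Euc n)) (φ : Euc n → PV n) (_ : K.IsParametrization W φ), K.localMeasure W φ

end SkeletalStructure

end Skeletal

/-! ### Skeletal linking structures -/

section Linking

/-- The distance travelled by the linking flow at time `t`, for radius `r` and (finite) linking
value `l`. -/
noncomputable def linkingTime (r l t : ℝ) : ℝ :=
  if t ≤ 1 / 2 then 2 * t * r else 2 * (1 - t) * r + (2 * t - 1) * l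

/-- The linking flow `λ(z,t) = x + χ(z,t) u`. -/
noncomputable def linkingFlow {n : ℕ} (ℓ : PV n → ℝ≥0∞) (z : PV n) (t : ℝ) : Euc (n + 1) :=
  z.1 + linkingTime (radius z) (ℓ z).toReal t • unitField z

/-- The first half of the linking flow, given by its formula on `[0,1/2]`. -/
noncomputable def linkingFlowInner {n : ℕ} (z : PV n) (t : ℝ) : Euc (n + 1) :=
  z.1 + (2 * t * radius z) • unitField z

/-- The second half of the linking flow, given by its formula on `[1/2,1]`. -/
noncomputable def linkingFlowOuter {n : ℕ} (ℓ : PV n → ℝ≥0∞) (z : PV n) (t : ℝ) :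
    Euc (n + 1) :=
  z.1 + (2 * (1 - t) * radius z + (2 * t - 1) * (ℓ z).toReal) • unitField z

/-- A skeletal linking structure, in the unbounded case, for a multi-region configuration
`Ω_1, …, Ω_m` in `ℝ^{n+1}`.  The linking function `ℓ_i` takes the value `∞` exactly on the
part `M_{i,∞}` of the double without linking. -/
structure SkeletalLinkingStructure {n m : ℕ} (Ω : Fin m → Set (Euc (n + 1))) where
  /-- The skeletal structures of the regions. -/
  skel : Fin m → SkeletalStructure n
  isSkeletal : ∀ i, (skel i).IsSkeletalStructureFor (Ω i)
  /-- The linking functions. -/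
  ℓ : Fin m → PV n → ℝ≥0∞
  radius_le : ∀ i, ∀ z ∈ (skel i).double, ENNReal.ofReal (radius z) ≤ ℓ i z
  /-- The labeled refinements of the stratifications of the doubles. -/
  refinement : Fin m → Set (Set (PV n))
  isStratification : ∀ i, IsStratification (refinement i) (skel i).double
  refines : ∀ i, ∀ S ∈ refinement i, ∃ X ∈ (skel i).strata, ∀ z ∈ S, z.1 ∈ X
  /-- `M_{i,∞}` is a union of strata. -/
  unlinked_strata : ∀ i, ∀ S ∈ refinement i, (∀ z ∈ S, ℓ i z = ⊤) ∨ (∀ z ∈ S, ℓ i z ≠ ⊤)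
  /-- (L1) The linking functions are continuous where they are finite, and smooth on strata. -/
  ℓ_continuous : ∀ i,
    ContinuousOn (fun z => (ℓ i z).toReal) {z ∈ (skel i).double | ℓ i z ≠ ⊤}
  ℓ_smooth : ∀ i, ∀ S ∈ refinement i, (∀ z ∈ S, ℓ i z ≠ ⊤) →
    ContDiffOn ℝ ∞ (fun z => (ℓ i z).toReal) S
  /-- (L2) The linking flow is nonsingular on each stratum: on the first half of the time
  interval, and also on the second half if the stratum is associated to the part of the
  boundary not shared with other regions; it is constant on the second half for all other
  strata. -/
  nonsingular_inner : ∀ i, ∀ S ∈ refinement i, (∀ z ∈ S, ℓ i z ≠ ⊤) →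
    NonsingularOn linkingFlowInner S (Icc 0 (1 / 2))
  nonsingular_outer : ∀ i, ∀ S ∈ refinement i, (∀ z ∈ S, ℓ i z ≠ ⊤) →
    ((∀ z ∈ S, ∀ j, j ≠ i → radialFlow z 1 ∉ frontier (Ω j)) ∧
      NonsingularOn (linkingFlowOuter (ℓ i)) S (Icc (1 / 2) 1)) ∨
    ((∀ z ∈ S, ∃ j, j ≠ i ∧ radialFlow z 1 ∈ frontier (Ω j)) ∧
      ∀ z ∈ S, ℓ i z = ENNReal.ofReal (radius z))
  /-- (L2) The images of the linking flow do not overlap, except where linking lines meet at their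
  ends, and away from time zero they do not return to the skeletal sets. -/
  linkingFlow_inj : ∀ i j, ∀ z ∈ (skel i).double, ∀ z' ∈ (skel j).double,
    ℓ i z ≠ ⊤ → ℓ j z' ≠ ⊤ → ∀ t ∈ Ioc (0 : ℝ) 1, ∀ t' ∈ Ioc (0 : ℝ) 1,
    linkingFlow (ℓ i) z t = linkingFlow (ℓ j) z' t' →
    (i = j ∧ z = z' ∧ linkingTime (radius z) (ℓ i z).toReal t =
      linkingTime (radius z') (ℓ j z').toReal t') ∨
    (linkingTime (radius z) (ℓ i z).toReal t = (ℓ i z).toReal ∧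
      linkingTime (radius z') (ℓ j z').toReal t' = (ℓ j z').toReal)
  linkingFlow_notMem : ∀ i j, ∀ z ∈ (skel i).double, ℓ i z ≠ ⊤ → ∀ t ∈ Ioc (0 : ℝ) 1,
    linkingFlow (ℓ i) z t ∉ (skel j).M
  /-- (L2), (L3) The images `W = {x + L(x) : x ∈ S}` of the strata at the end of the linking flow
  are smooth, agree or are disjoint, and form a stratified set, the linking axis `M_0`. -/
  linkingAxis : IsStratification
    {W | ∃ i, ∃ S ∈ refinement i, (∀ z ∈ S, ℓ i z ≠ ⊤) ∧
      W = (fun z => linkingFlow (ℓ i) z 1) '' S}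
    (⋃ i, (fun z => linkingFlow (ℓ i) z 1) '' {z ∈ (skel i).double | ℓ i z ≠ ⊤})
  /-- (L4) The radial flow from `M_∞`, for positive times, is injective and nonsingular on
  strata, and its image is the complement of the image of the linking flow (which
  starts from the skeletal sets). -/
  unlinked_inj : ∀ i j, ∀ z ∈ (skel i).double, ∀ z' ∈ (skel j).double,
    ℓ i z = ⊤ → ℓ j z' = ⊤ → ∀ t t' : ℝ, 0 < t → 0 < t' →
    radialFlow z t = radialFlow z' t' → i = j ∧ z = z' ∧ t = t'
  unlinked_nonsingular : ∀ i, ∀ S ∈ refinement i, (∀ z ∈ S, ℓ i z = ⊤) →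
    NonsingularOn radialFlow S (Ici 0)
  unlinked_image : ∀ y : Euc (n + 1),
    (∃ i, ∃ z ∈ (skel i).double, ℓ i z = ⊤ ∧ ∃ t : ℝ, 0 < t ∧ radialFlow z t = y) ↔
    (∀ i, y ∉ (skel i).M) ∧
    ¬ ∃ i, ∃ z ∈ (skel i).double, ℓ i z ≠ ⊤ ∧ ∃ t ∈ Ioc (0 : ℝ) 1, linkingFlow (ℓ i) z t = y

namespace SkeletalLinkingStructure

variable {n m : ℕ} {Ω : Fin m → Set (Euc (n + 1))} (L : SkeletalLinkingStructure Ω)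

/-- The measure `dM_i` on the double `M̃_i`. -/
noncomputable def dM (i : Fin m) : Measure (PV n) := (L.skel i).skeletalMeasure

/-- The interval of parameters `t` with `a ≤ t ≤ b`, where `b` may be infinite. -/
def interval (a : ℝ) (b : ℝ≥0∞) : Set ℝ := {t | a ≤ t ∧ ENNReal.ofReal t ≤ b}

/-- The integrand `g(x + t u) det(I - t S_rad)` along the line from the point `z` of `M̃_i`. -/
noncomputable def lineIntegrand (i : Fin m) (g : Euc (n + 1) → ℝ) (z : PV n) (t : ℝ) : ℝ :=
  g (z.1 + t • unitField z) * (L.skel i).shapeDet z t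

/-- For `h(z) = ∫_{a(z)}^{b(z)} g(x + t u) det(I - t S_rad) dt` on `M̃`: on each `M̃_i` the
integral defining `h` exists almost everywhere, and `h` is integrable. -/
def LineIntegrable (g : Euc (n + 1) → ℝ) (a : PV n → ℝ) (b : Fin m → PV n → ℝ≥0∞) : Prop :=
  ∀ i, (∀ᵐ z ∂(L.dM i), IntegrableOn (L.lineIntegrand i g z) (interval (a z) (b i z))) ∧
    Integrable (fun z => ∫ t in interval (a z) (b i z), L.lineIntegrand i g z t) (L.dM i)

/-- `g̃(z) = ∫_0^ℓ g(x + t u) det(I - t S_rad) dt` on `M̃_i`. -/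
noncomputable def gTilde (g : Euc (n + 1) → ℝ) (i : Fin m) (z : PV n) : ℝ :=
  ∫ t in interval 0 (L.ℓ i z), L.lineIntegrand i g z t

/-- `g̃_int(z) = ∫_0^r g(x + t u) det(I - t S_rad) dt` on `M̃_i`. -/
noncomputable def gInt (g : Euc (n + 1) → ℝ) (i : Fin m) (z : PV n) : ℝ :=
  ∫ t in interval 0 (ENNReal.ofReal (radius z)), L.lineIntegrand i g z t

/-- `g̃_ext(z) = ∫_r^ℓ g(x + t u) det(I - t S_rad) dt` on `M̃_i`. -/
noncomputable def gExt (g : Euc (n + 1) → ℝ) (i : Fin m) (z : PV n) : ℝ :=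
  ∫ t in interval (radius z) (L.ℓ i z), L.lineIntegrand i g z t

/-- `m_Q(z) = ∫_0^ℓ χ_Q(x + t u) det(I - t S_rad) dt` on `M̃_i`. -/
noncomputable def crofton (Q : Set (Euc (n + 1))) (i : Fin m) (z : PV n) : ℝ :=
  L.gTilde (Q.indicator (fun _ => 1)) i z

/-- The skeletal linking integral `∫_{M̃} h dM = ∑_i ∫_{M̃_i} h_i dM_i`. -/
noncomputable def integral (h : Fin m → PV n → ℝ) : ℝ := ∑ i, ∫ z, h i z ∂(L.dM i)

end SkeletalLinkingStructure

end Linking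

end SkeletalLinking

/-! The map `ray`, `(z, t) ↦ x + t u`, sends the pairs with `0 < t < ℓ(z)` over all doubles
bijectively onto almost all of `ℝ^{n+1}`. The theorem is the change of variables formula for this
map, followed by Fubini.

Jacobian. Along a local parametrization of the regular double, the derivative of `u` is `-S_rad`
plus a multiple of `u`. Column operations therefore turn the Jacobian at time `t` into the Jacobian
at time `0` times `det (I - t S_rad)` (`IsParametrization.rayDet_eq`). Splitting `u` into tangential
and normal parts identifies the Jacobian at time `0`, up to sign, with the density of `ρ dV`
(`IsParametrization.abs_rayDet_zero`). Nonsingularity of the flows keeps `det (I - t S_rad)` away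
from zero along the lines; since it equals `1` at `t = 0`, it is positive there
(`SkeletalLinkingStructure.shapeDet_pos`), and no absolute value remains in the formula.

Bijectivity. Lines can meet only at their ends (`injective_ray`). What the open lines miss lies in
the skeletal sets, the ends of the linking flow, and the lines from strata of dimension less than
`n`. These are countable unions of differentiable images of spaces of dimension at most `n`, hence
null (`ae_mem_iUnion_image_ray`).

The measure. `skeletalMeasure` is a supremum over an uncountable family of parametrizations. Each
local measure is rewritten as the integral of one fixed function over the part of the region swept
out by inner lines (`localMeasure_eq_lintegral`), so it depends only on the subset of the double. A
countable atlas then expresses `skeletalMeasure` as a countable sum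
(`IsAtlas.skeletalMeasure_eq_sum`), and `IsAtlas.map_ray` shows that `det (I - t S_rad) dM dt`
pushes forward to Lebesgue measure. Cutting each line at `t = r` gives the decomposition, and an
indicator function gives the Crofton formula. -/

namespace SkeletalLinking

/-! ### Charts, tangent spaces and dimension of embedded submanifolds. -/

section Submanifolds

variable {F : Type*} [NormedAddCommGroup F] [NormedSpace ℝ F]

/-- `φ : W → A` is a smooth chart of `A` onto `A ∩ O`, with continuous inverse `c`. -/
structure IsChart {k : ℕ} (A O : Set F) (W : Set (Euc k)) (φ : Euc k → F) (c : F → Euc k) :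
    Prop where
  isOpen_source : IsOpen W
  isOpen_target : IsOpen O
  smooth : ContDiffOn ℝ ∞ φ W
  immersion : ∀ w ∈ W, Function.Injective (fderiv ℝ φ w)
  left_inv : ∀ w ∈ W, c (φ w) = w
  image_eq : φ '' W = A ∩ O
  continuousOn : ContinuousOn c O

theorem IsChart.injOn {k : ℕ} {A O : Set F} {W : Set (Euc k)} {φ : Euc k → F} {c : F → Euc k}
    (h : IsChart A O W φ c) : InjOn φ W := fun a ha b hb hab => by
  rw [← h.left_inv a ha, ← h.left_inv b hb, hab]

theorem IsChart.mapsTo {k : ℕ} {A O : Set F} {W : Set (Euc k)} {φ : Euc k → F} {c : F → Euc k}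
    (h : IsChart A O W φ c) : MapsTo φ W A := fun _ hw =>
  (h.image_eq.subset (mem_image_of_mem φ hw)).1

theorem IsChart.hasFDerivAt {k : ℕ} {A O : Set F} {W : Set (Euc k)} {φ : Euc k → F}
    {c : F → Euc k} (h : IsChart A O W φ c) {w : Euc k} (hw : w ∈ W) :
    HasFDerivAt φ (fderiv ℝ φ w) w :=
  ((h.smooth.contDiffAt (h.isOpen_source.mem_nhds hw)).differentiableAt (by simp)).hasFDerivAt

/-- The derivative of a map into `A` has values in the tangent cone of `A`. -/
theorem mem_tangentConeAt_of_hasFDerivAt {E : Type*} [NormedAddCommGroup E] [NormedSpace ℝ E]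
    {A : Set F} {φ : E → F} {φ' : E →L[ℝ] F} {W : Set E} {w : E}
    (hφ : HasFDerivAt φ φ' w) (hW : W ∈ 𝓝 w) (hA : MapsTo φ W A) (v : E) :
    φ' v ∈ tangentConeAt ℝ A (φ w) := by
  have h := (hφ.hasFDerivWithinAt (s := W)).mapsTo_tangent_cone
  have hu : v ∈ tangentConeAt ℝ W w := by
    rw [tangentConeAt_of_mem_nhds hW]; trivial
  exact tangentConeAt_mono hA.image_subset (h hu)

theorem mem_tangentSpan_of_hasFDerivAt {E : Type*} [NormedAddCommGroup E] [NormedSpace ℝ E]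
    {A : Set F} {φ : E → F} {φ' : E →L[ℝ] F} {W : Set E} {w : E}
    (hφ : HasFDerivAt φ φ' w) (hW : W ∈ 𝓝 w) (hA : MapsTo φ W A) (v : E) :
    φ' v ∈ tangentSpan A (φ w) :=
  Submodule.subset_span (mem_tangentConeAt_of_hasFDerivAt hφ hW hA v)

theorem tangentSpan_congr {A B : Set F} {x : F} (h : 𝓝[A] x = 𝓝[B] x) :
    tangentSpan A x = tangentSpan B x := by
  rw [tangentSpan, tangentSpan, tangentConeAt_congr h]

variable [FiniteDimensional ℝ F]

theorem IsSmoothSubmanifold.exists_linear_model {k : ℕ} {V : Submodule ℝ F}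
    (hV : Module.finrank ℝ V = k) :
    ∃ (ι : Euc k →L[ℝ] F) (p : F →L[ℝ] Euc k), (∀ w, p (ι w) = w) ∧
      (∀ w, ι w ∈ V) ∧ ∀ v ∈ V, ι (p v) = v := by
  have e : Euc k ≃ₗ[ℝ] V := LinearEquiv.ofFinrankEq _ _ (by simp [hV])
  let ι : Euc k →ₗ[ℝ] F := V.subtype ∘ₗ e.toLinearMap
  have hι : ι.ker = ⊥ := by
    rw [LinearMap.ker_eq_bot]
    exact V.injective_subtype.comp e.injective
  obtain ⟨p, hp⟩ := ι.exists_leftInverse_of_injective hι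
  have hp' : ∀ w, p (ι w) = w := fun w => LinearMap.congr_fun hp w
  refine ⟨ι.toContinuousLinearMap, p.toContinuousLinearMap, hp', fun w => (e w).2, ?_⟩
  intro v hv
  have : v = ι (e.symm ⟨v, hv⟩) := by simp [ι]
  change ι (p v) = v
  rw [this, hp']

/-- With a flattening diffeomorphism `e` and linear coordinates `ι`, `p` on the model subspace, take
`φ = e.symm ∘ ι` and `c = p ∘ e`. Differentiating `c ∘ φ = id` shows that `φ` is an immersion. -/
theorem IsSmoothSubmanifold.exists_isChart {k : ℕ} {A : Set F} (hA : IsSmoothSubmanifold k A)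
    {x : F} (hx : x ∈ A) :
    ∃ (O : Set F) (W : Set (Euc k)) (φ : Euc k → F) (c : F → Euc k),
      x ∈ O ∧ IsChart A O W φ c := by
  obtain ⟨V, hV, e, hxe, -, he, hes, hAV⟩ := hA x hx
  obtain ⟨ι, p, hpι, hιV, hιp⟩ := IsSmoothSubmanifold.exists_linear_model hV
  have hW : IsOpen (ι ⁻¹' e.target) := e.open_target.preimage ι.continuous
  have hsm : ContDiffOn ℝ ∞ (fun w => e.symm (ι w)) (ι ⁻¹' e.target) :=
    hes.comp ι.contDiff.contDiffOn (fun _ hw => hw)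
  refine ⟨e.source, ι ⁻¹' e.target, fun w => e.symm (ι w), fun y => p (e y), hxe, hW,
    e.open_source, hsm, ?_, ?_, ?_, ?_⟩
  · intro w hw
    have h1 : HasFDerivAt (fun w => e.symm (ι w)) (fderiv ℝ (fun w => e.symm (ι w)) w) w :=
      ((hsm.contDiffAt (hW.mem_nhds hw)).differentiableAt (by simp)).hasFDerivAt
    have h2 : HasFDerivAt e (fderiv ℝ e (e.symm (ι w))) (e.symm (ι w)) :=
      ((he.contDiffAt (e.open_source.mem_nhds (e.map_target hw))).differentiableAt
        (by simp)).hasFDerivAt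
    have h3 := (p.hasFDerivAt (x := e (e.symm (ι w)))).comp w (h2.comp w h1)
    have h4 : HasFDerivAt (fun w : Euc k => w) (ContinuousLinearMap.id ℝ (Euc k)) w :=
      hasFDerivAt_id w
    have h5 := h4.congr_of_eventuallyEq (f₁ := p ∘ e ∘ fun w => e.symm (ι w)) (by
      filter_upwards [hW.mem_nhds hw] with y hy
      simp [e.right_inv hy, hpι])
    have h6 := h3.unique h5
    intro a b hab
    have ha := congrArg (fun L => L a) h6
    have hb := congrArg (fun L => L b) h6
    simp only [ContinuousLinearMap.comp_apply, ContinuousLinearMap.id_apply] at ha hb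
    rw [← ha, hab, hb]
  · intro w hw
    simp [e.right_inv hw, hpι]
  · ext y
    constructor
    · rintro ⟨w, hw, rfl⟩
      have h1 := e.map_target hw
      refine ⟨(hAV _ h1).2 ?_, h1⟩
      simp only [e.right_inv hw]
      exact hιV w
    · rintro ⟨hyA, hy⟩
      have h1 : ι (p (e y)) = e y := hιp _ ((hAV y hy).1 hyA)
      refine ⟨p (e y), ?_, ?_⟩
      · rw [mem_preimage, h1]; exact e.map_source hy
      · simp only [h1]; exact e.left_inv hy
  · exact p.continuous.comp_continuousOn he.continuousOn

theorem IsSmoothSubmanifold.finrank_tangentSpan {k : ℕ} {A : Set F}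
    (hA : IsSmoothSubmanifold k A) {x : F} (hx : x ∈ A) :
    Module.finrank ℝ (tangentSpan A x) = k := by
  apply le_antisymm
  · obtain ⟨V, hV, e, hxe, -, he, hes, hAV⟩ := hA x hx
    obtain ⟨ι, p, hpι, hιV, hιp⟩ := IsSmoothSubmanifold.exists_linear_model hV
    have h2 : HasFDerivAt e (fderiv ℝ e x) x :=
      ((he.contDiffAt (e.open_source.mem_nhds hxe)).differentiableAt (by simp)).hasFDerivAt
    have h3 : HasFDerivAt e.symm (fderiv ℝ e.symm (e x)) (e x) :=
      ((hes.contDiffAt (e.open_target.mem_nhds (e.map_source hxe))).differentiableAt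
        (by simp)).hasFDerivAt
    have h4 : ∀ v, fderiv ℝ e.symm (e x) (fderiv ℝ e x v) = v := by
      intro v
      have h5 := (hasFDerivAt_id (𝕜 := ℝ) x).congr_of_eventuallyEq (f₁ := e.symm ∘ e) (by
        filter_upwards [e.open_source.mem_nhds hxe] with y hy
        simp [e.left_inv hy])
      exact congrArg (fun L => L v) ((h3.comp x h2).unique h5)
    let q : F →L[ℝ] F := ContinuousLinearMap.id ℝ F - ι ∘L p
    -- `q` vanishes on `V`, and `e` carries `A` into `V`, so `q ∘ e` is zero on `A` near `x`; its
    -- derivative then kills the tangent cone, hence its span. Thus the injective map `fderiv ℝ e x`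
    -- sends the tangent span into `V`, of dimension `k`.
    have hq : tangentSpan A x ≤ (q ∘L fderiv ℝ e x).ker := by
      rw [tangentSpan, Submodule.span_le]
      intro v hv
      have hv' : v ∈ tangentConeAt ℝ (A ∩ e.source) x := by
        rwa [tangentConeAt_congr (nhdsWithin_inter_of_mem'
          (mem_nhdsWithin_of_mem_nhds (e.open_source.mem_nhds hxe)))]
      have h5 : HasFDerivWithinAt (q ∘ e) (q ∘L fderiv ℝ e x) (A ∩ e.source) x :=
        (q.hasFDerivAt.comp x h2).hasFDerivWithinAt
      have h6 : HasFDerivWithinAt (q ∘ e) (0 : F →L[ℝ] F) (A ∩ e.source) x := by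
        refine (hasFDerivWithinAt_const (0 : F) x (A ∩ e.source)).congr ?_ ?_
        · rintro y ⟨hy, hy'⟩
          simp [q, hιp _ ((hAV y hy').1 hy)]
        · simp [q, hιp _ ((hAV x hxe).1 hx)]
      exact h5.unique_on h6 hv'
    let f : tangentSpan A x →ₗ[ℝ] Euc k :=
      (p ∘L fderiv ℝ e x : F →L[ℝ] Euc k).toLinearMap ∘ₗ (tangentSpan A x).subtype
    have hf : Function.Injective f := by
      rw [← LinearMap.ker_eq_bot, LinearMap.ker_eq_bot']
      intro v hv
      have h5 : p (fderiv ℝ e x v) = 0 := hv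
      have h6 : fderiv ℝ e x v - ι (p (fderiv ℝ e x v)) = 0 := hq v.2
      rw [h5, map_zero, sub_zero] at h6
      have h7 := h4 v
      rw [h6, map_zero] at h7
      exact Subtype.ext h7.symm
    simpa using LinearMap.finrank_le_finrank_of_injective hf
  · obtain ⟨O, W, φ, c, hxO, h⟩ := hA.exists_isChart hx
    obtain ⟨w, hw, rfl⟩ := h.image_eq.superset ⟨hx, hxO⟩
    let f : Euc k →ₗ[ℝ] tangentSpan A (φ w) :=
      LinearMap.codRestrict _ (fderiv ℝ φ w).toLinearMap (fun v =>
        mem_tangentSpan_of_hasFDerivAt (h.hasFDerivAt hw) (h.isOpen_source.mem_nhds hw) h.mapsTo v)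
    have hf : Function.Injective f := fun a b hab =>
      h.immersion w hw (congrArg Subtype.val hab)
    simpa using LinearMap.finrank_le_finrank_of_injective hf

/-- A smooth immersion into a `k`-dimensional submanifold has a source of dimension at most
`k`. -/
theorem IsSmoothSubmanifold.le_of_immersion {j k : ℕ} {A : Set F} (hA : IsSmoothSubmanifold k A)
    {W : Set (Euc j)} {φ : Euc j → F} {φ' : Euc j →L[ℝ] F} {w : Euc j} (hW : W ∈ 𝓝 w)
    (hφ : HasFDerivAt φ φ' w) (hA' : MapsTo φ W A) (hinj : Function.Injective φ') : j ≤ k := by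
  rw [← hA.finrank_tangentSpan (hA' (mem_of_mem_nhds hW))]
  let f : Euc j →ₗ[ℝ] tangentSpan A (φ w) :=
    LinearMap.codRestrict _ φ'.toLinearMap (mem_tangentSpan_of_hasFDerivAt hφ hW hA')
  have hf : Function.Injective f := fun a b hab => hinj (congrArg Subtype.val hab)
  simpa using LinearMap.finrank_le_finrank_of_injective hf

/-- A submanifold is covered by countably many charts. -/
theorem IsSmoothSubmanifold.exists_countable_cover {k : ℕ} {A : Set F}
    (hA : IsSmoothSubmanifold k A) :
    ∃ (O : A → Set F) (W : A → Set (Euc k)) (φ : A → Euc k → F) (c : A → F → Euc k)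
      (T : Set A), T.Countable ∧ (∀ x, IsChart A (O x) (W x) (φ x) (c x)) ∧
        A = ⋃ x ∈ T, φ x '' W x := by
  choose O W φ c hxO h using fun x : A => hA.exists_isChart x.2
  have : ProperSpace F := FiniteDimensional.proper ℝ F
  obtain ⟨T, hT, hcov⟩ := TopologicalSpace.isOpen_iUnion_countable O
    (fun x => (h x).isOpen_target)
  refine ⟨O, W, φ, c, T, hT, h, ?_⟩
  simp_rw [fun x => (h x).image_eq, ← inter_iUnion₂, hcov]
  exact (inter_eq_left.2 fun x hx => mem_iUnion.2 ⟨⟨x, hx⟩, hxO _⟩).symm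

/-- Countably many charts cover `A`, and an injective continuous image of a Borel set is Borel
(Lusin–Souslin). -/
theorem IsSmoothSubmanifold.measurableSet [MeasurableSpace F] [BorelSpace F] {k : ℕ} {A : Set F}
    (hA : IsSmoothSubmanifold k A) : MeasurableSet A := by
  obtain ⟨O, W, φ, c, T, hT, h, hAT⟩ := hA.exists_countable_cover
  rw [hAT]
  exact MeasurableSet.biUnion hT fun x _ =>
    (h x).isOpen_source.measurableSet.image_of_continuousOn_injOn (h x).smooth.continuousOn
      (h x).injOn

end Submanifolds

/-! ### Null images of lower-dimensional spaces. -/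

/-- The image of a differentiable map from a space of smaller dimension is a null set. -/
theorem volume_image_eq_zero_of_finrank_lt {E : Type*} [NormedAddCommGroup E] [NormedSpace ℝ E]
    [FiniteDimensional ℝ E] {d : ℕ} (hd : Module.finrank ℝ E < d) {f : E → Euc d} {s : Set E}
    (hf : DifferentiableOn ℝ f s) : volume (f '' s) = 0 := by
  -- Embedding `E` as a proper subspace of `Euc d` makes source and target dimensions equal: `f ∘ p`
  -- is differentiable on the null set `j '' s`, and differentiable maps preserve null sets.
  obtain ⟨j, hj⟩ : ∃ j : E →ₗ[ℝ] Euc d, Function.Injective j := by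
    refine Module.Free.exists_linearMap_injective_of_lift_rank_lt ?_
    rw [← Module.finrank_eq_rank, ← Module.finrank_eq_rank]
    simpa only [Cardinal.lift_natCast, finrank_euclideanSpace_fin, Nat.cast_lt] using hd
  obtain ⟨p, hp⟩ := j.exists_leftInverse_of_injective (LinearMap.ker_eq_bot.2 hj)
  have hp' : ∀ x, p (j x) = x := LinearMap.congr_fun hp
  have h1 : volume (j '' s) = 0 := by
    refine measure_mono_null (t := (j.range : Set (Euc d))) ?_ (Measure.addHaar_submodule _ _ ?_)
    · rintro _ ⟨x, -, rfl⟩; exact ⟨x, rfl⟩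
    · intro h
      have h2 := LinearMap.finrank_range_of_inj hj
      rw [h, finrank_top, finrank_euclideanSpace_fin] at h2
      omega
  have h2 : DifferentiableOn ℝ (fun y => f (p y)) (j '' s) := by
    refine hf.comp p.toContinuousLinearMap.differentiable.differentiableOn ?_
    rintro _ ⟨x, hx, rfl⟩
    rwa [hp']
  have h3 := addHaar_image_eq_zero_of_differentiableOn_of_addHaar_eq_zero volume h2 h1
  rw [image_image] at h3
  simpa only [hp'] using h3

/-- The point at distance `t` from `z.1` along the unit field. -/
noncomputable def ray {n : ℕ} (z : PV n) (t : ℝ) : Euc (n + 1) := z.1 + t • unitField z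

/-! ### The double and the shape operator over the regular strata. -/

namespace SkeletalStructure

variable {n : ℕ} (K : SkeletalStructure n)

theorem ne_zero_of_mem_double {z : PV n} (hz : z ∈ K.double) : z.2 ≠ 0 := fun h =>
  K.U_ne_zero z.1 hz.1 (h ▸ hz.2)

theorem tangentSpan_of_mem_regularPart {X : Set (Euc (n + 1))} (hX : X ∈ K.strata)
    (hn : IsSmoothSubmanifold n X) {x : Euc (n + 1)} (hx : x ∈ X) :
    tangentSpan K.M x = tangentSpan X x := by
  obtain ⟨O, hO, hMO⟩ := K.regular_open X hX hn
  apply tangentSpan_congr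
  have hxO : x ∈ O := (hMO.superset hx).2
  rw [← hMO, nhdsWithin_inter_of_mem' (mem_nhdsWithin_of_mem_nhds (hO.mem_nhds hxO))]

theorem finrank_tangentSpan {z : PV n} (hz : z ∈ K.regularDouble) :
    Module.finrank ℝ (tangentSpan K.M z.1) = n := by
  obtain ⟨X, ⟨hX, hn⟩, hx⟩ := hz.2
  rw [K.tangentSpan_of_mem_regularPart hX hn hx, hn.finrank_tangentSpan hx]

/-- Near a regular point the double is the graph of a smooth vector field. -/
theorem tangentSpan_double {z : PV n} (hz : z ∈ K.regularDouble) :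
    z.2 ∉ tangentSpan K.M z.1 ∧
    ∃ V' : Euc (n + 1) →L[ℝ] Euc (n + 1), ∀ p ∈ tangentSpan K.double z,
      p.1 ∈ tangentSpan K.M z.1 ∧ p.2 = V' p.1 := by
  obtain ⟨O, hO, hxO, V₁, V₂, hV₁, hV₂, hV⟩ := K.U_regular z.1 hz.2
  have hzM : z.1 ∈ K.M ∩ O := ⟨hz.1.1, hxO⟩
  obtain ⟨ν, hν, hν0⟩ : ∃ ν ∈ (tangentSpan K.M z.1)ᗮ, ν ≠ 0 := by
    apply Submodule.exists_mem_ne_zero_of_ne_bot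
    intro h
    rw [Submodule.orthogonal_eq_bot_iff] at h
    have := K.finrank_tangentSpan hz
    rw [h, finrank_top, finrank_euclideanSpace_fin] at this
    omega
  have hpos := (hV z.1 hzM).2 ν hν hν0
  obtain ⟨V, V₃, hVs, hV₃s, hVU, hVz, hne⟩ : ∃ V V₃ : Euc (n + 1) → Euc (n + 1),
      ContDiffOn ℝ ∞ V (K.M ∩ O) ∧ ContDiffOn ℝ ∞ V₃ (K.M ∩ O) ∧
      (∀ x ∈ K.M ∩ O, K.U x = {V x, V₃ x}) ∧ z.2 = V z.1 ∧
      inner ℝ (V z.1) ν * inner ℝ (V₃ z.1) ν < 0 := by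
    have h2 : z.2 ∈ K.U z.1 := hz.1.2
    rw [(hV z.1 hzM).1] at h2
    rcases h2 with h2 | h2
    · exact ⟨V₁, V₂, hV₁, hV₂, fun x hx => (hV x hx).1, h2, hpos⟩
    · exact ⟨V₂, V₁, hV₂, hV₁, fun x hx => by rw [(hV x hx).1, pair_comm], h2,
        by rwa [mul_comm]⟩
  refine ⟨fun h => ?_, ?_⟩
  · have h0 : inner ℝ z.2 ν = 0 := hν _ h
    rw [hVz] at h0
    rw [h0, zero_mul] at hne
    exact lt_irrefl _ hne
  have hVV₃ : V z.1 ≠ V₃ z.1 := by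
    intro h
    rw [← h] at hne
    exact absurd hne (not_lt.2 (mul_self_nonneg _))
  obtain ⟨V', hV'⟩ := (hVs.differentiableOn (by simp)) z.1 hzM
  refine ⟨V', ?_⟩
  -- the double coincides with the graph of `V` near `z`
  have hev : ∀ᶠ y in 𝓝[K.double] z, y.1 ∈ K.M ∩ O ∧ y.2 = V y.1 := by
    have hfst : Tendsto Prod.fst (𝓝[K.double] z) (𝓝[K.M ∩ O] z.1) := by
      rw [nhdsWithin_inter_of_mem' (mem_nhdsWithin_of_mem_nhds (hO.mem_nhds hxO))]
      exact (continuous_fst.continuousWithinAt.tendsto_nhdsWithin fun y hy => hy.1)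
    -- The two values of `U` at `z.1` are distinct, so a nearby point of the double cannot lie on
    -- the other sheet `V₃` and must lie on `V`.
    have h3 : Tendsto (fun y : PV n => y.2 - V₃ y.1) (𝓝[K.double] z)
        (𝓝 (z.2 - V₃ z.1)) :=
      (continuous_snd.continuousWithinAt).tendsto.sub
        ((hV₃s.continuousOn z.1 hzM).tendsto.comp hfst)
    have h4 := h3.eventually_ne (b₂ := 0) (by rw [hVz]; exact sub_ne_zero.2 hVV₃)
    filter_upwards [h4, hfst.eventually self_mem_nhdsWithin, self_mem_nhdsWithin]
      with y hy hyM hyd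
    refine ⟨hyM, ?_⟩
    have h5 : y.2 ∈ K.U y.1 := hyd.2
    rw [hVU y.1 hyM] at h5
    exact h5.resolve_right fun h => hy (sub_eq_zero.2 h)
  have hfst : MapsTo (ContinuousLinearMap.fst ℝ (Euc (n + 1)) (Euc (n + 1)))
      (tangentConeAt ℝ K.double z) (tangentConeAt ℝ K.M z.1) := fun p hp => by
    have h := (hasFDerivWithinAt_fst (𝕜 := ℝ) (s := K.double) (p := z)).mapsTo_tangent_cone hp
    refine tangentConeAt_mono ?_ h
    rintro _ ⟨y, hy, rfl⟩
    exact hy.1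
  -- Both claims cut out a linear subspace, so it is enough to check them on the tangent cone. There
  -- the second one follows by differentiating `y.2 - V y.1`, which vanishes on the double near `z`.
  have hsub : tangentSpan K.double z ≤
      (tangentSpan K.M z.1).comap (LinearMap.fst ℝ _ _) ⊓
        (LinearMap.snd ℝ _ _ - V'.toLinearMap ∘ₗ LinearMap.fst ℝ _ _).ker := by
    rw [tangentSpan, Submodule.span_le]
    intro p hp
    refine ⟨Submodule.subset_span (hfst hp), ?_⟩
    set s := {y : PV n | y ∈ K.double ∧ y.1 ∈ K.M ∩ O ∧ y.2 = V y.1} with hs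
    have hps : p ∈ tangentConeAt ℝ s z := by
      have h : 𝓝[s] z = 𝓝[K.double] z := by
        apply nhdsWithin_inter_of_mem'
        exact hev
      rwa [tangentConeAt_congr h]
    have h1 : HasFDerivWithinAt (fun y : PV n => y.2 - V y.1)
        (ContinuousLinearMap.snd ℝ _ _ - V' ∘L ContinuousLinearMap.fst ℝ _ _) s z := by
      refine hasFDerivWithinAt_snd.sub (HasFDerivWithinAt.comp z hV' hasFDerivWithinAt_fst ?_)
      intro y hy
      exact hy.2.1
    have h2 : HasFDerivWithinAt (fun y : PV n => y.2 - V y.1)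
        (0 : PV n →L[ℝ] Euc (n + 1)) s z := by
      refine (hasFDerivWithinAt_const (0 : Euc (n + 1)) z s).congr ?_ ?_
      · intro y hy; exact sub_eq_zero.2 hy.2.2
      · exact sub_eq_zero.2 hVz
    exact h1.unique_on h2 hps
  intro p hp
  have := hsub hp
  exact ⟨this.1, sub_eq_zero.1 this.2⟩

/-- The radial shape operator exists at regular points. -/
theorem isRadialShapeOperator_radialShape {z : PV n} (hz : z ∈ K.regularDouble) :
    K.IsRadialShapeOperator z (K.radialShape z) := by
  -- `radialShape` is a Hilbert choice, so everything rests on the existence of one operator. It is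
  -- minus the projection to the tangent space of the derivative of `u` along the graph direction
  -- `(v, V' v)`, the only tangent vector of the double over `v`.
  apply Classical.epsilon_spec
  obtain ⟨hzT, V', hV'⟩ := K.tangentSpan_double hz
  set T := tangentSpan K.M z.1
  have hz0 : z.2 ≠ 0 := K.ne_zero_of_mem_double hz.1
  have hcompl : IsCompl T (ℝ ∙ z.2) := by
    have hdis : Disjoint T (ℝ ∙ z.2) := Submodule.disjoint_span_singleton_of_notMem hzT
    refine ⟨hdis, ?_⟩
    rw [codisjoint_iff]
    apply Submodule.eq_top_of_finrank_eq
    have h1 := Submodule.finrank_sup_add_finrank_inf_eq T (ℝ ∙ z.2)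
    rw [hdis.eq_bot, finrank_bot, finrank_span_singleton hz0, K.finrank_tangentSpan hz] at h1
    rw [finrank_euclideanSpace_fin]
    exact h1
  let D : Euc (n + 1) →ₗ[ℝ] Euc (n + 1) :=
    (fderiv ℝ unitField z).toLinearMap ∘ₗ LinearMap.prod LinearMap.id V'.toLinearMap
  refine ⟨-(Submodule.projectionOnto T _ hcompl ∘ₗ D ∘ₗ T.subtype), ?_⟩
  intro v w hvw
  obtain ⟨-, hw⟩ := hV' _ hvw
  have h2 : fderiv ℝ unitField z ((v : Euc (n + 1)), w) = D v := by
    simp only at hw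
    rw [hw]; rfl
  have h3 := Submodule.projection_add_projection_eq_self hcompl (D v)
  obtain ⟨c, hc⟩ := Submodule.mem_span_singleton.1
    (Submodule.projection_apply_mem hcompl.symm (D v))
  refine ⟨c, ?_⟩
  rw [h2, hc]
  conv_lhs => rw [← h3]
  simp

end SkeletalStructure

/-! ### Determinants of maps `ℝ^n × ℝ → ℝ^{n+1}`. -/

section LinearAlgebra

/-- The splitting of `ℝ^{n+1}` into the first `n` coordinates and the last one. -/
noncomputable def splitLast (n : ℕ) : Euc (n + 1) ≃L[ℝ] Euc n × ℝ :=
  LinearEquiv.toContinuousLinearEquiv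
    { toFun := fun x => (WithLp.toLp 2 fun i => x i.castSucc, x (Fin.last n))
      invFun := fun p => WithLp.toLp 2 (Fin.snoc (α := fun _ => ℝ) (WithLp.ofLp p.1) p.2)
      map_add' := fun x y => rfl
      map_smul' := fun c x => rfl
      left_inv := fun x => by
        ext i
        refine Fin.lastCases ?_ (fun i => ?_) i <;> simp
      right_inv := fun p => by
        ext i <;> simp }

theorem splitLast_apply {n : ℕ} (x : Euc (n + 1)) :
    splitLast n x = (WithLp.toLp 2 fun i => x i.castSucc, x (Fin.last n)) := rfl

theorem measurePreserving_splitLast (n : ℕ) :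
    MeasurePreserving (splitLast n) volume volume := by
  have h1 := EuclideanSpace.volume_preserving_symm_measurableEquiv_toLp (Fin (n + 1))
  have h2 := volume_preserving_piFinSuccAbove (fun _ : Fin (n + 1) => ℝ) (Fin.last n)
  have h3 := (PiLp.volume_preserving_toLp (Fin n)).prod (MeasurePreserving.id (volume : Measure ℝ))
  have h4 : MeasurePreserving Prod.swap (volume : Measure (ℝ × (Fin n → ℝ))) volume :=
    Measure.measurePreserving_swap
  have h5 := h3.comp (h4.comp (h2.comp h1))
  have h6 : ⇑(splitLast n) = Prod.map (WithLp.toLp 2) id ∘ Prod.swap ∘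
      (MeasurableEquiv.piFinSuccAbove (fun _ : Fin (n + 1) => ℝ) (Fin.last n)) ∘
        (MeasurableEquiv.toLp 2 (Fin (n + 1) → ℝ)).symm := by
    funext x
    refine Prod.ext ?_ rfl
    ext i
    simp [splitLast_apply, MeasurableEquiv.piFinSuccAbove, Fin.insertNthEquiv]
    rfl
  rw [h6]
  exact h5

theorem inner_eq_splitLast {n : ℕ} (x y : Euc (n + 1)) :
    inner ℝ x y = inner ℝ (splitLast n x).1 (splitLast n y).1 +
      (splitLast n x).2 * (splitLast n y).2 := by
  simp [splitLast_apply, PiLp.inner_apply, Fin.sum_univ_castSucc, mul_comm]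

/-- The determinant of a linear map `ℝ^n × ℝ → ℝ^{n+1}`. -/
noncomputable def splitDet {n : ℕ} (A : Euc n × ℝ →ₗ[ℝ] Euc (n + 1)) : ℝ :=
  LinearMap.det (A ∘ₗ (splitLast n).toLinearEquiv.toLinearMap)

theorem splitDet_comp {n : ℕ} (A : Euc n × ℝ →ₗ[ℝ] Euc (n + 1))
    (B : Euc n × ℝ →ₗ[ℝ] Euc n × ℝ) :
    splitDet (A ∘ₗ B) = splitDet A * LinearMap.det B := by
  have h := LinearMap.det_conj B (splitLast n).symm.toLinearEquiv
  rw [splitDet, splitDet, ← h, ← LinearMap.det_comp]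
  congr 1
  ext x : 1
  simp

theorem splitDet_ne_zero_iff {n : ℕ} {A : Euc n × ℝ →ₗ[ℝ] Euc (n + 1)} :
    splitDet A ≠ 0 ↔ Function.Injective A := by
  rw [splitDet, ← isUnit_iff_ne_zero, ← LinearMap.isUnit_iff_isUnit_det,
    LinearMap.isUnit_iff_ker_eq_bot, LinearMap.ker_eq_bot]
  have h : Function.Bijective (splitLast n).toLinearEquiv.toLinearMap :=
    (splitLast n).toLinearEquiv.bijective
  rw [LinearMap.coe_comp]
  exact Function.Injective.of_comp_iff' _ h

/-- Block triangular determinant. This form serves the splitting of `u` into tangential part `a` and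
normal part `q`; the lower triangular form below serves the passage from time `0` to time `t`. -/
theorem det_prod_upper {E : Type*} [AddCommGroup E] [Module ℝ E] [FiniteDimensional ℝ E]
    (P : E →ₗ[ℝ] E) (a : E) (q : ℝ) :
    LinearMap.det ((P ∘ₗ LinearMap.fst ℝ E ℝ + (LinearMap.snd ℝ E ℝ).smulRight a).prod
      (q • LinearMap.snd ℝ E ℝ)) = LinearMap.det P * q := by
  let b := Module.finBasis ℝ E
  let b' := Module.Basis.singleton Unit ℝ
  rw [← LinearMap.det_toMatrix (b.prod b'), ← LinearMap.det_toMatrix b]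
  have h : LinearMap.toMatrix (b.prod b') (b.prod b')
      ((P ∘ₗ LinearMap.fst ℝ E ℝ + (LinearMap.snd ℝ E ℝ).smulRight a).prod
        (q • LinearMap.snd ℝ E ℝ)) = Matrix.fromBlocks (LinearMap.toMatrix b b P)
        (Matrix.of fun i _ => b.repr a i) 0 (Matrix.of fun _ _ => q) := by
    ext (i | i) (j | j) <;> simp [LinearMap.toMatrix_apply, b']
  rw [h, Matrix.det_fromBlocks_zero₂₁, Matrix.det_unique (Matrix.of _), Matrix.of_apply]

theorem det_prod_lower {E : Type*} [AddCommGroup E] [Module ℝ E] [FiniteDimensional ℝ E]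
    (P : E →ₗ[ℝ] E) (c : E →ₗ[ℝ] ℝ) (q : ℝ) :
    LinearMap.det ((P ∘ₗ LinearMap.fst ℝ E ℝ).prod
      (c ∘ₗ LinearMap.fst ℝ E ℝ + q • LinearMap.snd ℝ E ℝ)) = LinearMap.det P * q := by
  let b := Module.finBasis ℝ E
  let b' := Module.Basis.singleton Unit ℝ
  rw [← LinearMap.det_toMatrix (b.prod b'), ← LinearMap.det_toMatrix b]
  have h : LinearMap.toMatrix (b.prod b') (b.prod b')
      ((P ∘ₗ LinearMap.fst ℝ E ℝ).prod
      (c ∘ₗ LinearMap.fst ℝ E ℝ + q • LinearMap.snd ℝ E ℝ)) =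
        Matrix.fromBlocks (LinearMap.toMatrix b b P) 0 (Matrix.of fun _ j => c (b j))
          (Matrix.of fun _ _ => q) := by
    ext (i | i) (j | j) <;> simp [LinearMap.toMatrix_apply, b']
  rw [h, Matrix.det_fromBlocks_zero₁₂, Matrix.det_unique (Matrix.of _), Matrix.of_apply]

theorem det_adjoint {E : Type*} [NormedAddCommGroup E] [InnerProductSpace ℝ E]
    [FiniteDimensional ℝ E] (f : E →ₗ[ℝ] E) :
    LinearMap.det (LinearMap.adjoint f) = LinearMap.det f := by
  let b := stdOrthonormalBasis ℝ E
  rw [← LinearMap.det_toMatrix b.toBasis, LinearMap.toMatrix_adjoint b b,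
    Matrix.det_conjTranspose, LinearMap.det_toMatrix]
  rfl

theorem det_adjoint_comp_self {n : ℕ} {E : Type*} [NormedAddCommGroup E] [InnerProductSpace ℝ E]
    [FiniteDimensional ℝ E] (f : Euc n →ₗ[ℝ] E) :
    LinearMap.det (LinearMap.adjoint f ∘ₗ f) =
      (Matrix.gram ℝ fun j : Fin n => f (EuclideanSpace.single j 1)).det := by
  let b := EuclideanSpace.basisFun (Fin n) ℝ
  rw [← LinearMap.det_toMatrix b.toBasis]
  congr 1
  ext i j
  have h := b.repr_apply_apply (LinearMap.adjoint f (f (EuclideanSpace.single j 1))) i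
  rw [LinearMap.adjoint_inner_right] at h
  simpa [LinearMap.toMatrix_apply, Matrix.gram_apply, b] using h

/-- The determinant of `(h, s) ↦ f h + s ν`, where `ν` is a unit normal to the range of `f`. -/
theorem splitDet_sq_of_normal {n : ℕ} (f : Euc n →ₗ[ℝ] Euc (n + 1)) (ν : Euc (n + 1))
    (hν : ‖ν‖ = 1) (hfν : ∀ h, inner ℝ (f h) ν = 0) :
    splitDet (f ∘ₗ LinearMap.fst ℝ (Euc n) ℝ + (LinearMap.snd ℝ (Euc n) ℝ).smulRight ν) ^ 2 =
      (Matrix.gram ℝ fun j : Fin n => f (EuclideanSpace.single j 1)).det := by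
  set A := f ∘ₗ LinearMap.fst ℝ (Euc n) ℝ + (LinearMap.snd ℝ (Euc n) ℝ).smulRight ν
  set AJ := A ∘ₗ (splitLast n).toLinearEquiv.toLinearMap with hAJ
  -- The squared determinant is that of `A* A`, which is block diagonal because `ν` is a unit vector
  -- orthogonal to the range of `f`: the blocks are the Gram operator of `f` and `1`.
  have h1 : LinearMap.det (LinearMap.adjoint AJ ∘ₗ AJ) = splitDet A ^ 2 := by
    rw [LinearMap.det_comp, det_adjoint, sq]; rfl
  let G : Euc n × ℝ →ₗ[ℝ] Euc n × ℝ :=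
    ((LinearMap.adjoint f ∘ₗ f) ∘ₗ LinearMap.fst ℝ (Euc n) ℝ +
      (LinearMap.snd ℝ (Euc n) ℝ).smulRight 0).prod ((1 : ℝ) • LinearMap.snd ℝ (Euc n) ℝ)
  have h2 : LinearMap.adjoint AJ ∘ₗ AJ = (splitLast n).symm.toLinearEquiv.toLinearMap ∘ₗ G ∘ₗ
      (splitLast n).symm.toLinearEquiv.symm.toLinearMap := by
    ext1 x
    refine ext_inner_left ℝ fun y => ?_
    rw [LinearMap.comp_apply, LinearMap.adjoint_inner_right, inner_eq_splitLast y]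
    have hfν' : ∀ h, inner ℝ ν (f h) = 0 := fun h => by rw [real_inner_comm]; exact hfν h
    simp [AJ, A, G, inner_add_left, inner_add_right, inner_smul_left, inner_smul_right, hfν,
      hfν', LinearMap.adjoint_inner_right, hν, mul_comm]
  rw [← h1, h2, LinearMap.det_conj, det_prod_upper, det_adjoint_comp_self, mul_one]

end LinearAlgebra

/-! ### The Jacobian of the flow along the unit field. -/

theorem norm_unitField {n : ℕ} {z : PV n} (hz : z.2 ≠ 0) : ‖unitField z‖ = 1 := by
  rw [unitField, norm_smul, norm_inv, norm_norm, inv_mul_cancel₀ (norm_ne_zero_iff.2 hz)]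

theorem contDiffAt_unitField {n : ℕ} {z : PV n} (hz : z.2 ≠ 0) :
    ContDiffAt ℝ ∞ (unitField (n := n)) z := by
  have h : ContDiffAt ℝ ∞ (fun y : PV n => ‖y.2‖) z := contDiffAt_snd.norm ℝ hz
  exact (h.inv (norm_ne_zero_iff.2 hz)).smul contDiffAt_snd

theorem measurable_unitField {n : ℕ} : Measurable (unitField (n := n)) := by
  unfold unitField; fun_prop

theorem measurable_ray {n : ℕ} : Measurable fun p : PV n × ℝ => ray p.1 p.2 := by
  unfold ray
  have := measurable_unitField (n := n)
  fun_prop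

namespace SkeletalStructure

variable {n : ℕ} {K : SkeletalStructure n}

theorem starProjection_ne_zero {z : PV n} (hz : z ∈ K.regularDouble) :
    (tangentSpan K.M z.1)ᗮ.starProjection z.2 ≠ 0 := by
  intro h
  rw [Submodule.starProjection_apply_eq_zero_iff, Submodule.orthogonal_orthogonal] at h
  exact (K.tangentSpan_double hz).1 h

theorem norm_unitNormal {z : PV n} (hz : z ∈ K.regularDouble) : ‖K.unitNormal z‖ = 1 := by
  rw [unitNormal, norm_smul, norm_inv, norm_norm,
    inv_mul_cancel₀ (norm_ne_zero_iff.2 (starProjection_ne_zero hz))]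

theorem inner_unitNormal {z : PV n} {v : Euc (n + 1)} (hv : v ∈ tangentSpan K.M z.1) :
    inner ℝ v (K.unitNormal z) = 0 := by
  rw [unitNormal, inner_smul_right]
  rw [(Submodule.starProjection_apply_mem (tangentSpan K.M z.1)ᗮ z.2) v hv, mul_zero]

theorem rho_eq {z : PV n} (hz : z ∈ K.regularDouble) :
    K.rho z = ‖z.2‖⁻¹ * ‖(tangentSpan K.M z.1)ᗮ.starProjection z.2‖ := by
  have h0 := starProjection_ne_zero hz
  set p := (tangentSpan K.M z.1)ᗮ.starProjection z.2
  have h1 : inner ℝ (z.2 - p) p = 0 := by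
    rw [real_inner_comm]
    exact Submodule.sub_starProjection_mem_orthogonal z.2 p (Submodule.starProjection_apply_mem _ _)
  rw [inner_sub_left, sub_eq_zero, real_inner_self_eq_norm_sq] at h1
  rw [rho, unitField, unitNormal, real_inner_smul_left, real_inner_smul_right, h1]
  change ‖z.2‖⁻¹ * (‖p‖⁻¹ * ‖p‖ ^ 2) = _
  have := norm_ne_zero_iff.2 h0
  field_simp

theorem rho_pos {z : PV n} (hz : z ∈ K.regularDouble) : 0 < K.rho z := by
  rw [rho_eq hz]
  exact mul_pos (inv_pos.2 (norm_pos_iff.2 (K.ne_zero_of_mem_double hz.1)))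
    (norm_pos_iff.2 (starProjection_ne_zero hz))

/-- The decomposition of the unit field into tangential and normal parts. -/
theorem unitField_sub_mem {z : PV n} (hz : z ∈ K.regularDouble) :
    unitField z - K.rho z • K.unitNormal z ∈ tangentSpan K.M z.1 := by
  rw [rho_eq hz, unitField, unitNormal, smul_smul, mul_assoc,
    mul_inv_cancel₀ (norm_ne_zero_iff.2 (starProjection_ne_zero hz)), mul_one, ← smul_sub]
  apply Submodule.smul_mem
  have h := Submodule.sub_starProjection_mem_orthogonal (K := (tangentSpan K.M z.1)ᗮ) z.2
  rwa [Submodule.orthogonal_orthogonal] at h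

variable {W : Set (Euc n)} {φ : Euc n → PV n}

theorem IsParametrization.ne_zero (h : K.IsParametrization W φ) {w : Euc n} (hw : w ∈ W) :
    (φ w).2 ≠ 0 :=
  K.ne_zero_of_mem_double (h.mapsTo hw).1

theorem IsParametrization.contDiffAt (h : K.IsParametrization W φ) {w : Euc n} (hw : w ∈ W) :
    ContDiffAt ℝ ∞ φ w :=
  h.smooth.contDiffAt (h.isOpen.mem_nhds hw)

theorem contDiffOn_ray {E : Type*} [NormedAddCommGroup E] [NormedSpace ℝ E]
    {W : Set E} {φ : E → PV n} (h : ContDiffOn ℝ ∞ φ W) (h0 : ∀ w ∈ W, (φ w).2 ≠ 0) :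
    ContDiffOn ℝ ∞ (fun p : E × ℝ => ray (φ p.1) p.2) (W ×ˢ univ) := by
  have h1 : ContDiffOn ℝ ∞ (fun p : E × ℝ => φ p.1) (W ×ˢ univ) :=
    h.comp contDiff_fst.contDiffOn fun p hp => hp.1
  have h2 : ContDiffOn ℝ ∞ (fun p : E × ℝ => unitField (φ p.1)) (W ×ˢ univ) := fun p hp =>
    ContDiffAt.comp_contDiffWithinAt (g := unitField) (f := fun p : E × ℝ => φ p.1) p
      (contDiffAt_unitField (h0 p.1 hp.1)) (h1 p hp)
  unfold ray
  exact (contDiff_fst.comp_contDiffOn h1).add (contDiff_snd.contDiffOn.smul h2)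

/-- The derivative of the flow along the unit field in a parametrization. -/
theorem IsParametrization.hasFDerivAt_ray (h : K.IsParametrization W φ) {w : Euc n} (hw : w ∈ W)
    (t : ℝ) :
    HasFDerivAt (fun p : Euc n × ℝ => ray (φ p.1) p.2)
      (((fderiv ℝ (fun w => (φ w).1) w + t • (fderiv ℝ unitField (φ w) ∘L fderiv ℝ φ w)) ∘L
        ContinuousLinearMap.fst ℝ (Euc n) ℝ) +
        (ContinuousLinearMap.snd ℝ (Euc n) ℝ).smulRight (unitField (φ w))) (w, t) := by
  have hφ : HasFDerivAt φ (fderiv ℝ φ w) w :=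
    ((h.contDiffAt hw).differentiableAt (by simp)).hasFDerivAt
  have hξ : HasFDerivAt (fun w => (φ w).1) (fderiv ℝ (fun w => (φ w).1) w) w :=
    (hφ.fst.differentiableAt).hasFDerivAt
  have hu : HasFDerivAt (unitField (n := n)) (fderiv ℝ unitField (φ w)) (φ w) :=
    ((contDiffAt_unitField (h.ne_zero hw)).differentiableAt (by simp)).hasFDerivAt
  have h1 : HasFDerivAt (fun p : Euc n × ℝ => (φ p.1).1) _ (w, t) :=
    HasFDerivAt.comp (g := fun w => (φ w).1) (f := Prod.fst) (w, t) hξ hasFDerivAt_fst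
  have h2 : HasFDerivAt (fun p : Euc n × ℝ => unitField (φ p.1)) _ (w, t) :=
    HasFDerivAt.comp (g := unitField ∘ φ) (f := Prod.fst) (w, t) (hu.comp w hφ) hasFDerivAt_fst
  have h3 : HasFDerivAt (Prod.snd : Euc n × ℝ → ℝ) (ContinuousLinearMap.snd ℝ (Euc n) ℝ) (w, t) :=
    hasFDerivAt_snd
  have h4 := h1.add (h3.smul h2)
  refine h4.congr_fderiv ?_
  ext p
  all_goals simp

/-- The Jacobian determinant of the flow along the unit field in a parametrization. -/
noncomputable def rayDet (φ : Euc n → PV n) (p : Euc n × ℝ) : ℝ :=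
  splitDet (fderiv ℝ (fun p : Euc n × ℝ => ray (φ p.1) p.2) p).toLinearMap

theorem IsParametrization.fderiv_mem (h : K.IsParametrization W φ) {w : Euc n} (hw : w ∈ W)
    (v : Euc n) : fderiv ℝ (fun w => (φ w).1) w v ∈ tangentSpan K.M (φ w).1 :=
  mem_tangentSpan_of_hasFDerivAt
    (((h.contDiffAt hw).differentiableAt (by simp)).hasFDerivAt.fst.differentiableAt).hasFDerivAt
    (h.isOpen.mem_nhds hw) (fun _ hy => (h.mapsTo hy).1.1) v

/-- The derivative of a parametrization as an isomorphism to the tangent space. -/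
theorem IsParametrization.exists_equiv (h : K.IsParametrization W φ) {w : Euc n} (hw : w ∈ W) :
    ∃ e : Euc n ≃ₗ[ℝ] tangentSpan K.M (φ w).1,
      ∀ v, (e v : Euc (n + 1)) = fderiv ℝ (fun w => (φ w).1) w v := by
  let f : Euc n →ₗ[ℝ] tangentSpan K.M (φ w).1 :=
    LinearMap.codRestrict _ (fderiv ℝ (fun w => (φ w).1) w).toLinearMap (h.fderiv_mem hw)
  have hf : Function.Injective f := fun a b hab =>
    h.immersion w hw (congrArg Subtype.val hab)
  exact ⟨LinearEquiv.ofInjectiveOfFinrankEq f hf (by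
    rw [finrank_tangentSpan _ (h.mapsTo hw), finrank_euclideanSpace_fin]), fun v => rfl⟩

theorem shapeDet_zero (z : PV n) : K.shapeDet z 0 = 1 := by
  simp [shapeDet]

/-- In the coordinates of `φ` the derivative of `u` is `-ξ' ∘ S + c u`. Hence the derivative of the
flow at time `t` is its derivative at time `0` composed with a block triangular map whose diagonal
blocks are `I - t S` and `1`. -/
theorem IsParametrization.rayDet_eq (h : K.IsParametrization W φ) {w : Euc n} (hw : w ∈ W)
    (t : ℝ) : rayDet φ (w, t) = rayDet φ (w, 0) * K.shapeDet (φ w) t := by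
  set z := φ w with hz
  have hzr : z ∈ K.regularDouble := h.mapsTo hw
  have hz0 : z.2 ≠ 0 := h.ne_zero hw
  set ξ' := fderiv ℝ (fun w => (φ w).1) w
  obtain ⟨e, he⟩ := h.exists_equiv hw
  set u' := fderiv ℝ unitField z ∘L fderiv ℝ φ w with hu'
  have hφ : HasFDerivAt φ (fderiv ℝ φ w) w :=
    ((h.contDiffAt hw).differentiableAt (by simp)).hasFDerivAt
  have hspec : ∀ v, ∃ c : ℝ, u' v = -(K.radialShape z (e v) : Euc (n + 1)) + c • z.2 := by
    intro v
    have h1 : fderiv ℝ φ w v ∈ tangentSpan K.double z :=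
      mem_tangentSpan_of_hasFDerivAt hφ (h.isOpen.mem_nhds hw) (fun _ hy => (h.mapsTo hy).1) v
    have h2 : fderiv ℝ φ w v = ((e v : Euc (n + 1)), (fderiv ℝ φ w v).2) := by
      refine Prod.ext ?_ rfl
      rw [he]
      change _ = fderiv ℝ (fun w => (φ w).1) w v
      rw [hφ.fst.fderiv]; rfl
    have h3 := K.isRadialShapeOperator_radialShape hzr (e v) (fderiv ℝ φ w v).2 (h2 ▸ h1)
    rwa [← h2] at h3
  let S : Euc n →ₗ[ℝ] Euc n := e.symm.toLinearMap ∘ₗ K.radialShape z ∘ₗ e.toLinearMap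
  have heS : ∀ v, ξ' (S v) = K.radialShape z (e v) := fun v => by
    rw [← he]; simp [S]
  -- The shape operator equation gives the coefficient of `u` only vector by vector. Pairing with
  -- the unit vector `u` recovers it as a linear functional.
  let c : Euc n →ₗ[ℝ] ℝ := (innerSL ℝ (unitField z)).toLinearMap ∘ₗ
    (u'.toLinearMap + (ξ'.toLinearMap ∘ₗ S))
  have hc : ∀ v, u' v = -ξ' (S v) + c v • unitField z := by
    intro v
    obtain ⟨a, ha⟩ := hspec v
    have h1 : u' v + ξ' (S v) = (a * ‖z.2‖) • unitField z := by
      rw [ha, heS, unitField, smul_smul, mul_assoc, mul_inv_cancel₀ (norm_ne_zero_iff.2 hz0)]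
      simp
    have h2 : c v = a * ‖z.2‖ := by
      have : c v = inner ℝ (unitField z) (u' v + ξ' (S v)) := rfl
      rw [this, h1, inner_smul_right, real_inner_self_eq_norm_sq, norm_unitField hz0]
      simp
    rw [h2, ← h1]; abel
  let B : Euc n × ℝ →ₗ[ℝ] Euc n × ℝ :=
    ((LinearMap.id - t • S) ∘ₗ LinearMap.fst ℝ (Euc n) ℝ).prod
      ((t • c) ∘ₗ LinearMap.fst ℝ (Euc n) ℝ + (1 : ℝ) • LinearMap.snd ℝ (Euc n) ℝ)
  have h1 : (fderiv ℝ (fun p : Euc n × ℝ => ray (φ p.1) p.2) (w, t)).toLinearMap =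
      (fderiv ℝ (fun p : Euc n × ℝ => ray (φ p.1) p.2) (w, 0)).toLinearMap ∘ₗ B := by
    rw [(h.hasFDerivAt_ray hw t).fderiv, (h.hasFDerivAt_ray hw 0).fderiv]
    refine LinearMap.ext fun p => ?_
    change ξ' p.1 + t • u' p.1 + p.2 • unitField z =
      ξ' (p.1 - t • S p.1) + (0 : ℝ) • u' (p.1 - t • S p.1) +
        (t • c p.1 + (1 : ℝ) • p.2) • unitField z
    rw [hc, map_sub, map_smul]
    simp only [zero_smul, smul_add, smul_neg, add_smul, smul_smul, smul_eq_mul, one_mul, add_zero]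
    abel
  have h2 : LinearMap.det B = K.shapeDet z t := by
    rw [det_prod_lower, mul_one, shapeDet, ← LinearMap.det_conj _ e.symm]
    congr 1
    ext v : 1
    simp [S]
  rw [rayDet, rayDet, h1, splitDet_comp, h2]

/-- Writing `u = ξ' a + ρ n`, the tangential part is removed by a column operation. The normal part
contributes `ρ`, and the remaining squared determinant is the Gram determinant. -/
theorem IsParametrization.abs_rayDet_zero (h : K.IsParametrization W φ) {w : Euc n}
    (hw : w ∈ W) : |rayDet φ (w, 0)| = K.rho (φ w) * volumeDensity φ w := by
  have hzr : φ w ∈ K.regularDouble := h.mapsTo hw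
  set z := φ w with hz
  set ξ' := fderiv ℝ (fun w => (φ w).1) w with hξ'
  obtain ⟨e, he⟩ := h.exists_equiv hw
  let a : Euc n := e.symm ⟨_, unitField_sub_mem hzr⟩
  have ha : ξ' a = unitField z - K.rho z • K.unitNormal z := by
    rw [hξ', ← he]; simp [a, hz]
  let B : Euc n × ℝ →ₗ[ℝ] Euc n × ℝ :=
    (LinearMap.id ∘ₗ LinearMap.fst ℝ (Euc n) ℝ + (LinearMap.snd ℝ (Euc n) ℝ).smulRight a).prod
      (K.rho z • LinearMap.snd ℝ (Euc n) ℝ)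
  have h1 : (fderiv ℝ (fun p : Euc n × ℝ => ray (φ p.1) p.2) (w, 0)).toLinearMap =
      (ξ'.toLinearMap ∘ₗ LinearMap.fst ℝ (Euc n) ℝ +
        (LinearMap.snd ℝ (Euc n) ℝ).smulRight (K.unitNormal z)) ∘ₗ B := by
    rw [(h.hasFDerivAt_ray hw 0).fderiv]
    refine LinearMap.ext fun p => ?_
    change ξ' p.1 + (0 : ℝ) • (fderiv ℝ unitField z (fderiv ℝ φ w p.1)) + p.2 • unitField z =
      ξ' (p.1 + p.2 • a) + (K.rho z • p.2) • K.unitNormal z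
    rw [map_add, map_smul, ha]
    simp only [zero_smul, add_zero, smul_sub, smul_smul, smul_eq_mul, mul_comm]
    abel
  have h2 := splitDet_sq_of_normal ξ'.toLinearMap (K.unitNormal z) (norm_unitNormal hzr)
    (fun v => inner_unitNormal (h.fderiv_mem hw v))
  rw [rayDet, h1, splitDet_comp, det_prod_upper, LinearMap.det_id, one_mul, abs_mul,
    abs_of_pos (rho_pos hzr), mul_comm, volumeDensity, ← Real.sqrt_sq_eq_abs, h2]
  rfl

/-- At time `0` this is transversality of `U` to the tangent space, together with the immersion
property. -/
theorem IsParametrization.rayDet_zero_ne_zero (h : K.IsParametrization W φ) {w : Euc n}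
    (hw : w ∈ W) : rayDet φ (w, 0) ≠ 0 := by
  have hzr : φ w ∈ K.regularDouble := h.mapsTo hw
  rw [rayDet, splitDet_ne_zero_iff, ← LinearMap.ker_eq_bot, LinearMap.ker_eq_bot',
    (h.hasFDerivAt_ray hw 0).fderiv]
  rintro ⟨v, s⟩ hvs
  replace hvs : fderiv ℝ (fun w => (φ w).1) w v +
      (0 : ℝ) • (fderiv ℝ unitField (φ w) (fderiv ℝ φ w v)) + s • unitField (φ w) = 0 := hvs
  rw [zero_smul, add_zero] at hvs
  have hs : s = 0 := by
    by_contra hs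
    refine (K.tangentSpan_double hzr).1 ?_
    have h1 : s • unitField (φ w) ∈ tangentSpan K.M (φ w).1 := by
      rw [← neg_eq_of_add_eq_zero_right hvs]
      exact Submodule.neg_mem _ (h.fderiv_mem hw v)
    rwa [unitField, smul_smul, Submodule.smul_mem_iff] at h1
    exact mul_ne_zero hs (inv_ne_zero (norm_ne_zero_iff.2 (h.ne_zero hw)))
  rw [hs, zero_smul, add_zero] at hvs
  rw [hs, h.immersion w hw (hvs.trans (map_zero _).symm)]
  rfl

end SkeletalStructure

/-! ### Change of variables, regularity and positivity of the shape determinant. -/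

/-- Change of variables for maps `ℝ^n × ℝ → ℝ^{n+1}`. -/
theorem lintegral_image_split {n : ℕ} {s : Set (Euc n × ℝ)} (hs : MeasurableSet s)
    {f : Euc n × ℝ → Euc (n + 1)} {f' : Euc n × ℝ → Euc n × ℝ →L[ℝ] Euc (n + 1)}
    (hf : ∀ p ∈ s, HasFDerivAt f (f' p) p) (hinj : InjOn f s) (g : Euc (n + 1) → ℝ≥0∞) :
    ∫⁻ y in f '' s, g y =
      ∫⁻ p in s, ENNReal.ofReal |splitDet (f' p).toLinearMap| * g (f p) := by
  let J := splitLast n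
  have hJ : MeasurableEmbedding J := J.toHomeomorph.measurableEmbedding
  have himg : f '' s = (f ∘ J) '' (J ⁻¹' s) := by
    rw [image_comp, image_preimage_eq _ J.surjective]
  rw [himg, lintegral_image_eq_lintegral_abs_det_fderiv_mul volume (hJ.measurable hs)
    (f' := fun x => f' (J x) ∘L (J : Euc (n + 1) →L[ℝ] Euc n × ℝ))
    (fun x hx => ((hf (J x) hx).comp x J.hasFDerivAt).hasFDerivWithinAt)
    (fun x hx y hy hxy => J.injective (hinj hx hy hxy))]
  exact (measurePreserving_splitLast n).setLIntegral_comp_preimage_emb hJ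
    (fun p => ENNReal.ofReal |splitDet (f' p).toLinearMap| * g (f p)) s

theorem radialFlow_eq_ray {n : ℕ} {z : PV n} (hz : z.2 ≠ 0) (t : ℝ) :
    radialFlow z t = ray z (t * radius z) := by
  rw [radialFlow, ray, unitField, radius, smul_smul, mul_assoc,
    mul_inv_cancel₀ (norm_ne_zero_iff.2 hz), mul_one]

theorem ray_eq_radialFlow {n : ℕ} {z : PV n} (hz : z.2 ≠ 0) (t : ℝ) :
    ray z t = radialFlow z (t / radius z) := by
  have hr : radius z ≠ 0 := norm_ne_zero_iff.2 hz
  rw [radialFlow_eq_ray hz, div_mul_cancel₀ _ hr]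

namespace SkeletalStructure

variable {n : ℕ} {K : SkeletalStructure n} {W : Set (Euc n)} {φ : Euc n → PV n}

theorem IsParametrization.contDiffOn_ray (h : K.IsParametrization W φ) :
    ContDiffOn ℝ ∞ (fun p : Euc n × ℝ => ray (φ p.1) p.2) (W ×ˢ univ) :=
  SkeletalStructure.contDiffOn_ray h.smooth fun _ hw => h.ne_zero hw

theorem IsParametrization.continuousOn_rayDet (h : K.IsParametrization W φ) :
    ContinuousOn (rayDet φ) (W ×ˢ univ) := by
  have h1 := h.contDiffOn_ray.continuousOn_fderiv_of_isOpen (h.isOpen.prod isOpen_univ)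
    (by simp)
  have h2 : ContinuousOn (fun p => fderiv ℝ (fun p : Euc n × ℝ => ray (φ p.1) p.2) p ∘L
      (splitLast n : Euc (n + 1) →L[ℝ] Euc n × ℝ)) (W ×ˢ univ) :=
    h1.clm_comp continuousOn_const
  exact ContinuousLinearMap.continuous_det.comp_continuousOn h2

/-- The shape operator is chosen separately at each point, so regularity of `shapeDet` in `(w, t)`
is not visible from its definition; it comes from this quotient of continuous Jacobians. -/
theorem IsParametrization.shapeDet_eq (h : K.IsParametrization W φ) {w : Euc n} (hw : w ∈ W)
    (t : ℝ) : K.shapeDet (φ w) t = rayDet φ (w, t) / rayDet φ (w, 0) := by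
  rw [h.rayDet_eq hw t, mul_div_cancel_left₀ _ (h.rayDet_zero_ne_zero hw)]

theorem IsParametrization.continuousOn_rayDet_zero (h : K.IsParametrization W φ) :
    ContinuousOn (fun w => rayDet φ (w, 0)) W :=
  h.continuousOn_rayDet.comp (by fun_prop) fun _ hw => ⟨hw, trivial⟩

theorem IsParametrization.continuousOn_shapeDet (h : K.IsParametrization W φ) :
    ContinuousOn (fun p : Euc n × ℝ => K.shapeDet (φ p.1) p.2) (W ×ˢ univ) := by
  have h1 : ContinuousOn (fun p : Euc n × ℝ => rayDet φ p / rayDet φ (p.1, 0)) (W ×ˢ univ) :=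
    h.continuousOn_rayDet.div (h.continuousOn_rayDet_zero.comp continuousOn_fst
      fun _ hp => hp.1) fun p hp => h.rayDet_zero_ne_zero hp.1
  exact h1.congr fun p hp => h.shapeDet_eq hp.1 p.2

/-- Nonsingularity of a flow which is a time change of the flow along the unit field. -/
theorem IsParametrization.shapeDet_ne_zero (h : K.IsParametrization W φ) {w : Euc n}
    (hw : w ∈ W) {f : PV n → ℝ → Euc (n + 1)} {S : Set (PV n)} {I : Set ℝ}
    (hf : NonsingularOn f S I) (hS : MapsTo φ W S) {χ : Euc n × ℝ → ℝ} {t : ℝ} (ht : t ∈ I)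
    (hχ : DifferentiableAt ℝ χ (w, t))
    (hfχ : ∀ w ∈ W, ∀ t, f (φ w) t = ray (φ w) (χ (w, t))) :
    K.shapeDet (φ w) (χ (w, t)) ≠ 0 := by
  have himm : ∀ w ∈ W, Function.Injective (fderiv ℝ φ w) := fun w hw a b hab => by
    have hφ : HasFDerivAt φ (fderiv ℝ φ w) w :=
      ((h.contDiffAt hw).differentiableAt (by simp)).hasFDerivAt
    apply h.immersion w hw
    rw [hφ.fst.fderiv]
    exact congrArg Prod.fst hab
  obtain ⟨-, h1⟩ := hf n W φ h.isOpen h.smooth hS himm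
  have h2 := h1 w hw t ht
  have hθ := (hasFDerivAt_fst (𝕜 := ℝ) (p := ((w, t) : Euc n × ℝ))).prodMk hχ.hasFDerivAt
  have h3 : HasFDerivAt (fun p : Euc n × ℝ => f (φ p.1) p.2) _ (w, t) :=
    (HasFDerivAt.comp (g := fun p : Euc n × ℝ => ray (φ p.1) p.2) (w, t)
      (h.hasFDerivAt_ray hw (χ (w, t))) hθ).congr_of_eventuallyEq (by
        filter_upwards [(h.isOpen.prod isOpen_univ).mem_nhds ⟨hw, mem_univ t⟩] with p hp
        exact hfχ p.1 hp.1 p.2)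
  -- The derivative of `f` factors through that of the time change `(w, t) ↦ (w, χ(w, t))`.
  -- Injectivity of the composite makes the inner factor injective, hence bijective by equality of
  -- dimensions, so the derivative of `ray` is injective too.
  rw [h3.fderiv, ContinuousLinearMap.coe_comp] at h2
  have h4 := h2.of_comp
  have h5 := (LinearMap.injective_iff_surjective (f := ContinuousLinearMap.toLinearMap
    ((ContinuousLinearMap.fst ℝ (Euc n) ℝ).prod (fderiv ℝ χ (w, t))))).1 h4
  have h6 := (Function.Injective.of_comp_iff' _ ⟨h4, h5⟩).1 h2
  have h7 : rayDet φ (w, χ (w, t)) ≠ 0 := by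
    rw [rayDet, splitDet_ne_zero_iff, (h.hasFDerivAt_ray hw _).fderiv]
    exact h6
  rw [h.rayDet_eq hw] at h7
  exact right_ne_zero_of_mul h7

theorem IsParametrization.differentiableAt_radius (h : K.IsParametrization W φ) {w : Euc n}
    (hw : w ∈ W) : DifferentiableAt ℝ (fun w => radius (φ w)) w :=
  DifferentiableAt.norm ℝ
    (((h.contDiffAt hw).differentiableAt (by simp)).snd) (h.ne_zero hw)

theorem IsParametrization.mono (h : K.IsParametrization W φ) {W' : Set (Euc n)}
    (hW' : IsOpen W') (hsub : W' ⊆ W) : K.IsParametrization W' φ :=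
  ⟨hW', h.smooth.mono hsub, h.injOn.mono hsub, h.mapsTo.mono_left hsub,
    fun w hw => h.immersion w (hsub hw)⟩

/-- The shape determinant does not vanish inside the region. -/
theorem shapeDet_ne_zero_of_le_radius {Ω : Set (Euc (n + 1))} (hK : K.IsSkeletalStructureFor Ω)
    (h : K.IsParametrization W φ) {w : Euc n} (hw : w ∈ W) {t : ℝ} (ht : 0 < t)
    (htr : t ≤ radius (φ w)) : K.shapeDet (φ w) t ≠ 0 := by
  obtain ⟨X, ⟨hX, hn⟩, hx⟩ := (h.mapsTo hw).2
  obtain ⟨O, hO, hMO⟩ := K.regular_open X hX hn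
  -- Nonsingularity is given stratum by stratum, so the parametrization is first shrunk to lie over
  -- the single stratum `X`, which is open in `M`.
  have hop : IsOpen (W ∩ (fun w => (φ w).1) ⁻¹' O) :=
    (continuous_fst.comp_continuousOn h.smooth.continuousOn).isOpen_inter_preimage h.isOpen hO
  have h' := h.mono hop inter_subset_left
  have hw' : w ∈ W ∩ (fun w => (φ w).1) ⁻¹' O := ⟨hw, (hMO.superset hx).2⟩
  have hr : 0 < radius (φ w) := norm_pos_iff.2 (h.ne_zero hw)
  have h1 := h'.shapeDet_ne_zero hw' (hK.nonsingular X hX)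
    (fun w hw => ⟨(h.mapsTo hw.1).1, hMO.subset ⟨(h.mapsTo hw.1).1.1, hw.2⟩⟩)
    (χ := fun p => p.2 * radius (φ p.1)) (t := t / radius (φ w))
    ⟨div_pos ht hr, (div_le_one hr).2 htr⟩
    (differentiableAt_snd.mul (DifferentiableAt.comp (g := fun w => radius (φ w))
      (w, t / radius (φ w)) (h.differentiableAt_radius hw) differentiableAt_fst))
    (fun w hw t => radialFlow_eq_ray (h.ne_zero hw.1) t)
  simpa [hr.ne'] using h1

/-- The determinant starts at `1` and is continuous in `t`; without zeros it cannot change sign. -/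
theorem IsParametrization.shapeDet_pos (h : K.IsParametrization W φ) {w : Euc n} (hw : w ∈ W)
    {b : ℝ} (hb : 0 ≤ b) (hne : ∀ t, 0 < t → t ≤ b → K.shapeDet (φ w) t ≠ 0) :
    0 < K.shapeDet (φ w) b := by
  have hc : Continuous fun t => K.shapeDet (φ w) t := by
    rw [← continuousOn_univ]
    exact h.continuousOn_shapeDet.comp (f := fun t : ℝ => (w, t)) (by fun_prop)
      fun t _ => ⟨hw, trivial⟩
  by_contra hneg
  obtain ⟨t, ht, ht0⟩ := intermediate_value_Icc' hb hc.continuousOn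
    (show (0 : ℝ) ∈ Icc _ _ from ⟨not_lt.1 hneg, by rw [shapeDet_zero]; exact zero_le_one⟩)
  rcases ht.1.eq_or_lt with h0 | h0
  · rw [← h0] at ht0
    simp [shapeDet_zero] at ht0
  · exact hne t h0 ht.2 ht0

end SkeletalStructure

theorem exists_measurable_eqOn {α β : Type*} [TopologicalSpace α] [MeasurableSpace α]
    [OpensMeasurableSpace α] [TopologicalSpace β] [MeasurableSpace β] [BorelSpace β] [Nonempty β]
    {s : Set α} (hs : MeasurableSet s) {f : α → β} (hf : ContinuousOn f s) :
    ∃ g, Measurable g ∧ EqOn g f s := by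
  classical
  obtain ⟨b⟩ := ‹Nonempty β›
  exact ⟨s.piecewise f fun _ => b, hf.measurable_piecewise continuousOn_const hs,
    piecewise_eqOn s f _⟩

/-! ### Local measures, independently of the parametrization. -/

namespace SkeletalStructure

variable {n : ℕ} {K : SkeletalStructure n} {W : Set (Euc n)} {φ : Euc n → PV n}

/-- Off `W` nothing is known about `φ` or the density, whereas the formulas for `Measure.map` and
`withDensity` ask for measurability. Modifying both outside `W` does not affect the measure. -/
theorem IsParametrization.exists_localMeasure_eq (h : K.IsParametrization W φ) :
    ∃ (ψ : Euc n → PV n) (δ : Euc n → ℝ≥0∞), Measurable ψ ∧ Measurable δ ∧ EqOn ψ φ W ∧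
      EqOn δ (fun w => ENNReal.ofReal |rayDet φ (w, 0)|) W ∧
      K.localMeasure W φ = ((volume.restrict W).withDensity δ).map ψ := by
  have hW := h.isOpen.measurableSet
  obtain ⟨ψ, hψ, hψφ⟩ := exists_measurable_eqOn hW h.smooth.continuousOn
  obtain ⟨δ, hδ, hδφ⟩ := exists_measurable_eqOn hW
    (ENNReal.continuous_ofReal.comp_continuousOn h.continuousOn_rayDet_zero.abs)
  refine ⟨ψ, δ, hψ, hδ, hψφ, hδφ, ?_⟩
  have h1 : (volume.restrict W).withDensity
      (fun w => ENNReal.ofReal (K.rho (φ w) * volumeDensity φ w)) =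
      (volume.restrict W).withDensity δ := by
    apply withDensity_congr_ae
    filter_upwards [ae_restrict_mem hW] with w hw
    rw [hδφ hw, ← h.abs_rayDet_zero hw]; rfl
  rw [localMeasure, h1]
  apply Measure.map_congr
  apply (withDensity_absolutelyContinuous _ _).ae_le
  filter_upwards [ae_restrict_mem hW] with w hw
  exact (hψφ hw).symm

theorem IsParametrization.measurableSet_preimage (h : K.IsParametrization W φ) {B : Set (PV n)}
    (hB : MeasurableSet B) : MeasurableSet (W ∩ φ ⁻¹' B) := by
  obtain ⟨ψ, hψ, hψφ⟩ := exists_measurable_eqOn h.isOpen.measurableSet h.smooth.continuousOn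
  rw [← hψφ.inter_preimage_eq]
  exact h.isOpen.measurableSet.inter (hψ hB)

theorem IsParametrization.localMeasure_apply (h : K.IsParametrization W φ) {B : Set (PV n)}
    (hB : MeasurableSet B) :
    K.localMeasure W φ B = ∫⁻ w in W ∩ φ ⁻¹' B, ENNReal.ofReal |rayDet φ (w, 0)| := by
  obtain ⟨ψ, δ, hψ, hδ, hψφ, hδφ, heq⟩ := h.exists_localMeasure_eq
  rw [heq, Measure.map_apply hψ hB, withDensity_apply _ (hψ hB),
    Measure.restrict_restrict (hψ hB), inter_comm, hψφ.inter_preimage_eq]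
  exact setLIntegral_congr_fun (h.measurableSet_preimage hB) fun w hw => hδφ hw.1

/-- Change of variables in a parametrization. -/
theorem IsParametrization.lintegral_image_ray (h : K.IsParametrization W φ)
    {s : Set (Euc n × ℝ)} (hs : MeasurableSet s) (hsW : ∀ p ∈ s, p.1 ∈ W)
    (hinj : InjOn (fun p : Euc n × ℝ => ray (φ p.1) p.2) s) (g : Euc (n + 1) → ℝ≥0∞) :
    ∫⁻ y in (fun p : Euc n × ℝ => ray (φ p.1) p.2) '' s, g y =
      ∫⁻ p in s, ENNReal.ofReal |rayDet φ (p.1, 0)| *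
        ENNReal.ofReal |K.shapeDet (φ p.1) p.2| * g (ray (φ p.1) p.2) := by
  rw [lintegral_image_split hs
    (f' := fun p => fderiv ℝ (fun p : Euc n × ℝ => ray (φ p.1) p.2) p)
    (fun p hp => (h.hasFDerivAt_ray (hsW p hp) p.2).differentiableAt.hasFDerivAt) hinj]
  refine setLIntegral_congr_fun hs fun p hp => ?_
  have h1 := h.rayDet_eq (hsW p hp) p.2
  rw [← ENNReal.ofReal_mul (abs_nonneg _), ← abs_mul, ← h1]
  rfl

/-- The points `(z, t)` of the lines from the double inside the region. -/
def innerLines (K : SkeletalStructure n) : Set (PV n × ℝ) :=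
  {p | p.1 ∈ K.double ∧ p.2 ∈ Ioc 0 (radius p.1)}

theorem injOn_innerLines {Ω : Set (Euc (n + 1))} (hK : K.IsSkeletalStructureFor Ω) :
    InjOn (fun p : PV n × ℝ => ray p.1 p.2) K.innerLines := by
  rintro ⟨z, t⟩ ⟨hz, ht⟩ ⟨z', t'⟩ ⟨hz', ht'⟩ heq
  have h0 := K.ne_zero_of_mem_double hz
  have h0' := K.ne_zero_of_mem_double hz'
  have hr : 0 < radius z := norm_pos_iff.2 h0
  have hr' : 0 < radius z' := norm_pos_iff.2 h0'
  simp only at heq hz hz' ht ht'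
  rw [ray_eq_radialFlow h0, ray_eq_radialFlow h0'] at heq
  have h1 := hK.bijOn.injOn (x₁ := (z, t / radius z)) (x₂ := (z', t' / radius z'))
    ⟨hz, div_pos ht.1 hr, (div_le_one hr).2 ht.2⟩
    ⟨hz', div_pos ht'.1 hr', (div_le_one hr').2 ht'.2⟩ heq
  obtain ⟨rfl, h2⟩ := Prod.mk.inj h1
  rw [div_left_inj' hr.ne'] at h2
  rw [h2]

/-- The inverse of the product of the radius with the shape determinant, as a function on the
region. -/
noncomputable def footWeight (K : SkeletalStructure n) (y : Euc (n + 1)) : ℝ≥0∞ :=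
  let q := Function.invFunOn (fun p : PV n × ℝ => ray p.1 p.2) K.innerLines y
  (ENNReal.ofReal (radius q.1) * ENNReal.ofReal |K.shapeDet q.1 q.2|)⁻¹

/-- Since inner lines do not meet, the foot point and time are functions of the point reached, so
this weight mentions no parametrization. It is chosen to cancel the shape determinant and to
normalize each inner line, of length `r`, to total weight one. -/
theorem footWeight_ray {Ω : Set (Euc (n + 1))} (hK : K.IsSkeletalStructureFor Ω)
    {p : PV n × ℝ} (hp : p ∈ K.innerLines) :
    K.footWeight (ray p.1 p.2) =
      (ENNReal.ofReal (radius p.1) * ENNReal.ofReal |K.shapeDet p.1 p.2|)⁻¹ := by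
  have h := (injOn_innerLines hK).leftInvOn_invFunOn hp
  rw [footWeight, h]

/-- The local measure in terms of Lebesgue measure in the region.  The right-hand side does not
depend on the parametrization. -/
theorem IsParametrization.localMeasure_eq_lintegral {Ω : Set (Euc (n + 1))}
    (hK : K.IsSkeletalStructureFor Ω) (h : K.IsParametrization W φ) {B : Set (PV n)}
    (hB : MeasurableSet B) :
    K.localMeasure W φ B =
      ∫⁻ y in (fun p : PV n × ℝ => ray p.1 p.2) ''
        {p | p.1 ∈ B ∩ φ '' W ∧ p.2 ∈ Ioc 0 (radius p.1)}, K.footWeight y := by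
  obtain ⟨ψ, δ, hψ, hδ, hψφ, hδφ, -⟩ := h.exists_localMeasure_eq
  have hr : Measurable fun w => radius (ψ w) := hψ.snd.norm
  set W' := W ∩ φ ⁻¹' B with hW'
  have hW'm : MeasurableSet W' := h.measurableSet_preimage hB
  set s : Set (Euc n × ℝ) := {p | p.1 ∈ W' ∧ p.2 ∈ Ioc 0 (radius (ψ p.1))} with hs
  have hsm : MeasurableSet s :=
    (measurable_fst hW'm).inter ((measurableSet_lt measurable_const measurable_snd).inter
      (measurableSet_le measurable_snd (hr.comp measurable_fst)))
  have himg : (fun p : PV n × ℝ => ray p.1 p.2) ''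
      {p | p.1 ∈ B ∩ φ '' W ∧ p.2 ∈ Ioc 0 (radius p.1)} =
      (fun p : Euc n × ℝ => ray (φ p.1) p.2) '' s := by
    ext y
    constructor
    · rintro ⟨⟨z, t⟩, ⟨⟨hzB, w, hw, rfl⟩, ht⟩, rfl⟩
      refine ⟨(w, t), ⟨⟨hw, hzB⟩, ?_⟩, rfl⟩
      simpa only [hψφ hw] using ht
    · rintro ⟨⟨w, t⟩, ⟨⟨hw, hwB⟩, ht⟩, rfl⟩
      refine ⟨(φ w, t), ⟨⟨hwB, w, hw, rfl⟩, ?_⟩, rfl⟩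
      simpa only [hψφ hw] using ht
  have hmem : ∀ p ∈ s, (φ p.1, p.2) ∈ K.innerLines := fun p hp =>
    ⟨(h.mapsTo hp.1.1).1, by simpa only [hψφ hp.1.1] using hp.2⟩
  have hinj : InjOn (fun p : Euc n × ℝ => ray (φ p.1) p.2) s := fun p hp q hq hpq => by
    have h1 := injOn_innerLines hK (hmem p hp) (hmem q hq) hpq
    obtain ⟨h2, h3⟩ := Prod.mk.inj h1
    exact Prod.ext (h.injOn hp.1.1 hq.1.1 h2) h3
  rw [himg, h.lintegral_image_ray hsm (fun p hp => hp.1.1) hinj, h.localMeasure_apply hB]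
  -- The weight cancels the shape determinant, which is nonzero on `0 < t ≤ r`. What is left is `δ /
  -- r`, whose integral over `(0, r]` is `δ`.
  have h1 : ∫⁻ p in s, ENNReal.ofReal |rayDet φ (p.1, 0)| *
        ENNReal.ofReal |K.shapeDet (φ p.1) p.2| * K.footWeight (ray (φ p.1) p.2) =
      ∫⁻ p in s, δ p.1 * (ENNReal.ofReal (radius (ψ p.1)))⁻¹ := by
    refine setLIntegral_congr_fun hsm fun p hp => ?_
    have hp2 := (hmem p hp).2
    have hD := shapeDet_ne_zero_of_le_radius hK h hp.1.1 hp2.1 hp2.2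
    rw [footWeight_ray hK (hmem p hp), hδφ hp.1.1, hψφ hp.1.1, mul_assoc,
      ENNReal.mul_inv (Or.inr ENNReal.ofReal_ne_top) (Or.inl ENNReal.ofReal_ne_top),
      mul_left_comm (ENNReal.ofReal |K.shapeDet (φ p.1) p.2|),
      ENNReal.mul_inv_cancel (by simpa using hD) ENNReal.ofReal_ne_top, mul_one]
  have h2 : Measurable fun p : Euc n × ℝ => δ p.1 * (ENNReal.ofReal (radius (ψ p.1)))⁻¹ :=
    (hδ.comp measurable_fst).mul (hr.comp measurable_fst).ennreal_ofReal.inv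
  rw [h1, ← lintegral_indicator hsm, Measure.volume_eq_prod,
    lintegral_prod _ (h2.indicator hsm).aemeasurable, ← lintegral_indicator hW'm]
  refine lintegral_congr fun w => ?_
  by_cases hw : w ∈ W'
  · have h3 : ∀ t, s.indicator (fun p : Euc n × ℝ => δ p.1 * (ENNReal.ofReal (radius (ψ p.1)))⁻¹)
        (w, t) = (Ioc 0 (radius (ψ w))).indicator
          (fun _ => δ w * (ENNReal.ofReal (radius (ψ w)))⁻¹) t := fun t => by
      by_cases ht : t ∈ Ioc 0 (radius (ψ w))
      · rw [indicator_of_mem ht, indicator_of_mem (show (w, t) ∈ s from ⟨hw, ht⟩)]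
      · rw [indicator_of_notMem ht, indicator_of_notMem fun h => ht h.2]
    have hr0 : 0 < radius (ψ w) := by
      rw [hψφ hw.1]; exact norm_pos_iff.2 (h.ne_zero hw.1)
    rw [indicator_of_mem hw, lintegral_congr h3, lintegral_indicator measurableSet_Ioc,
      setLIntegral_const, Real.volume_Ioc, sub_zero, mul_assoc, ENNReal.inv_mul_cancel
        (by simpa using hr0) ENNReal.ofReal_ne_top, mul_one, hδφ hw.1]
  · rw [indicator_of_notMem hw]
    exact ((lintegral_congr fun t => indicator_of_notMem
      (fun h : (w, t) ∈ s => hw h.1) _).trans lintegral_zero).symm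

end SkeletalStructure

/-! ### Countable atlases and the skeletal measure as a countable sum. -/

namespace SkeletalStructure

variable {n : ℕ} {K : SkeletalStructure n}

/-- A countable decomposition of `G` into Borel pieces `B k` contained in the images of
parametrizations `φ k`, with inverses `c k`. -/
structure IsAtlas (K : SkeletalStructure n) (G : Set (PV n)) (W : ℕ → Set (Euc n))
    (φ : ℕ → Euc n → PV n) (c : ℕ → PV n → Euc n) (B : ℕ → Set (PV n)) : Prop where
  param : ∀ k, K.IsParametrization (W k) (φ k)
  measurableSet : ∀ k, MeasurableSet (B k)
  disjoint : Pairwise (Function.onFun Disjoint B)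
  subset : ∀ k, B k ⊆ φ k '' W k
  iUnion_eq : ⋃ k, B k = G
  continuousOn : ∀ k, ContinuousOn (c k) (B k)
  left_inv : ∀ k, ∀ w ∈ W k, c k (φ k w) = w

theorem isParametrization_empty (K : SkeletalStructure n) (φ : Euc n → PV n) :
    K.IsParametrization ∅ φ :=
  ⟨isOpen_empty, contDiffOn_empty, injOn_empty _, mapsTo_empty _ _, fun _ hw => hw.elim⟩

/-- A countable union of smooth `n`-dimensional pieces of the regular double which are immersed
in `M` has an atlas. -/
theorem exists_isAtlas {𝒢 : Set (Set (PV n))} (h𝒢 : 𝒢.Countable)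
    (hsmooth : ∀ S ∈ 𝒢, IsSmoothSubmanifold n S) (hsub : ∀ S ∈ 𝒢, S ⊆ K.regularDouble)
    (himm : ∀ S ∈ 𝒢, ∀ O W φ c, IsChart S O W φ c → ∀ w ∈ W,
      Function.Injective (fderiv ℝ (fun w : Euc n => (φ w).1) w)) :
    ∃ W φ c B, K.IsAtlas (⋃₀ 𝒢) W φ c B := by
  choose O W φ c T hT hchart hcov using
    fun S : 𝒢 => (hsmooth S.1 S.2).exists_countable_cover
  have : Countable 𝒢 := h𝒢.to_subtype
  have : ∀ S : 𝒢, Countable (T S) := fun S => (hT S).to_subtype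
  -- The extra index `none`, carrying the empty chart, makes the index type nonempty, so that `ℕ`
  -- maps onto it even when there are no charts.
  obtain ⟨f, hf⟩ := exists_surjective_nat (Option (Σ S : 𝒢, T S))
  let W' : Option (Σ S : 𝒢, T S) → Set (Euc n) := fun o => o.elim ∅ fun p => W p.1 p.2
  let φ' : Option (Σ S : 𝒢, T S) → Euc n → PV n := fun o => o.elim 0 fun p => φ p.1 p.2
  let c' : Option (Σ S : 𝒢, T S) → PV n → Euc n := fun o => o.elim 0 fun p => c p.1 p.2
  have hparam : ∀ o, K.IsParametrization (W' o) (φ' o) := by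
    rintro (_ | ⟨S, x⟩)
    · exact isParametrization_empty K _
    · have h := hchart S x
      exact ⟨h.isOpen_source, h.smooth, h.injOn, fun w hw => hsub S.1 S.2 (h.mapsTo hw),
        himm S.1 S.2 _ _ _ _ h⟩
  have hinv : ∀ o, ∀ w ∈ W' o, c' o (φ' o w) = w := by
    rintro (_ | ⟨S, x⟩)
    · exact fun w hw => hw.elim
    · exact (hchart S x).left_inv
  have hcont : ∀ o, ContinuousOn (c' o) (φ' o '' W' o) := by
    rintro (_ | ⟨S, x⟩)
    · exact continuousOn_const
    · refine (hchart S x).continuousOn.mono ?_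
      exact (hchart S x).image_eq.subset.trans inter_subset_right
  refine ⟨fun k => W' (f k), fun k => φ' (f k), fun k => c' (f k),
    disjointed fun k => φ' (f k) '' W' (f k), fun k => hparam _, fun k => ?_,
    disjoint_disjointed _, fun k => disjointed_subset _ k, ?_, fun k => ?_, fun k => hinv _⟩
  · exact MeasurableSet.disjointed (fun k => (hparam (f k)).isOpen.measurableSet
      |>.image_of_continuousOn_injOn (hparam (f k)).smooth.continuousOn (hparam (f k)).injOn) k
  · rw [iUnion_disjointed, hf.iUnion_comp fun o => φ' o '' W' o, sUnion_eq_iUnion]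
    apply subset_antisymm
    · refine iUnion_subset ?_
      rintro (_ | ⟨S, x⟩)
      · rintro _ ⟨w, hw, -⟩
        exact hw.elim
      · rintro _ ⟨w, hw, rfl⟩
        exact mem_iUnion.2 ⟨S, (hchart S x).mapsTo hw⟩
    · refine iUnion_subset fun S z hz => ?_
      rw [hcov S] at hz
      obtain ⟨x, hx, hz⟩ := mem_iUnion₂.1 hz
      exact mem_iUnion.2 ⟨some ⟨S, x, hx⟩, hz⟩
  · exact (hcont (f k)).mono (disjointed_subset _ k)

variable {G : Set (PV n)} {W : ℕ → Set (Euc n)} {φ : ℕ → Euc n → PV n} {c : ℕ → PV n → Euc n}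
  {B : ℕ → Set (PV n)}

/-- Each local measure integrates the same weight over the inner lines from the parametrized set. On
a piece `B k`, which lies in the image of `φ k`, no parametrization can therefore exceed the `k`-th
one. Outside `G` every local measure vanishes, because by `hN` the lines from there are null. -/
theorem IsAtlas.skeletalMeasure_eq_sum {Ω : Set (Euc (n + 1))} (hK : K.IsSkeletalStructureFor Ω)
    (hA : K.IsAtlas G W φ c B)
    (hN : volume ((fun p : PV n × ℝ => ray p.1 p.2) '' ((K.regularDouble \ G) ×ˢ univ)) = 0) :
    K.skeletalMeasure =
      Measure.sum fun k => (K.localMeasure (W k) (φ k)).restrict (B k) := by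
  have hG : MeasurableSet G := hA.iUnion_eq ▸ MeasurableSet.iUnion hA.measurableSet
  apply le_antisymm
  · refine iSup_le fun W' => iSup_le fun φ' => iSup_le fun h => Measure.le_iff.2 fun C hC => ?_
    have h0 : K.localMeasure W' φ' (C \ G) = 0 := by
      rw [h.localMeasure_eq_lintegral hK (hC.diff hG)]
      apply setLIntegral_measure_zero
      refine measure_mono_null (image_mono ?_) hN
      rintro ⟨z, t⟩ ⟨⟨hz, w, hw, rfl⟩, -⟩
      exact ⟨⟨h.mapsTo hw, hz.2⟩, trivial⟩
    rw [← measure_inter_add_sdiff C hG, h0, add_zero, ← hA.iUnion_eq, inter_iUnion,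
      measure_iUnion (fun i j hij => (hA.disjoint hij).mono inter_subset_right inter_subset_right)
        (fun k => hC.inter (hA.measurableSet k)), Measure.sum_apply _ hC]
    refine ENNReal.tsum_le_tsum fun k => ?_
    rw [Measure.restrict_apply hC,
      h.localMeasure_eq_lintegral hK (hC.inter (hA.measurableSet k)),
      (hA.param k).localMeasure_eq_lintegral hK (hC.inter (hA.measurableSet k))]
    refine lintegral_mono_set (image_mono ?_)
    rintro p ⟨⟨hp, -⟩, ht⟩
    exact ⟨⟨hp, hA.subset k hp.2⟩, ht⟩
  -- Conversely, each local measure is below the supremum, and the pieces `B k` are disjoint, so the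
  -- restricted measures add up to at most the supremum.
  · refine Measure.le_iff.2 fun C hC => ?_
    have hle : ∀ k, K.localMeasure (W k) (φ k) ≤ K.skeletalMeasure := fun k =>
      le_iSup_of_le (W k) (le_iSup_of_le (φ k) (le_iSup_of_le (hA.param k) le_rfl))
    rw [Measure.sum_apply _ hC]
    calc ∑' k, (K.localMeasure (W k) (φ k)).restrict (B k) C
        ≤ ∑' k, K.skeletalMeasure (C ∩ B k) := ENNReal.tsum_le_tsum fun k => by
          rw [Measure.restrict_apply hC]; exact hle k _
      _ = K.skeletalMeasure (⋃ k, C ∩ B k) := (measure_iUnion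
          (fun i j hij => (hA.disjoint hij).mono inter_subset_right inter_subset_right)
          fun k => hC.inter (hA.measurableSet k)).symm
      _ ≤ K.skeletalMeasure C := measure_mono (iUnion_subset fun k => inter_subset_left)

theorem IsAtlas.exists_measurable_shapeDet (hA : K.IsAtlas G W φ c B) (k : ℕ) :
    ∃ D : PV n × ℝ → ℝ, Measurable D ∧
      EqOn D (fun p => K.shapeDet p.1 p.2) (B k ×ˢ univ) := by
  apply exists_measurable_eqOn ((hA.measurableSet k).prod MeasurableSet.univ)
  have h1 : ∀ z ∈ B k, c k z ∈ W k ∧ φ k (c k z) = z := by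
    intro z hz
    obtain ⟨w, hw, rfl⟩ := hA.subset k hz
    rw [hA.left_inv k w hw]
    exact ⟨hw, rfl⟩
  have h2 : ContinuousOn (fun p : PV n × ℝ => (c k p.1, p.2)) (B k ×ˢ univ) :=
    ((hA.continuousOn k).comp continuousOn_fst fun _ hp => hp.1).prodMk continuousOn_snd
  refine ((hA.param k).continuousOn_shapeDet.comp h2
    fun p hp => ⟨(h1 p.1 hp.1).1, trivial⟩).congr fun p hp => ?_
  simp only [Function.comp_apply]
  rw [(h1 p.1 hp.1).2]

theorem IsAtlas.aemeasurable_shapeDet (hA : K.IsAtlas G W φ c B) (μ : Measure (PV n × ℝ))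
    {A : Set (PV n × ℝ)} (hAG : ∀ p ∈ A, p.1 ∈ G) :
    AEMeasurable (fun p : PV n × ℝ => K.shapeDet p.1 p.2) (μ.restrict A) := by
  have h1 : AEMeasurable (fun p : PV n × ℝ => K.shapeDet p.1 p.2)
      (μ.restrict (⋃ k, B k ×ˢ univ)) := by
    rw [aemeasurable_iUnion_iff]
    intro k
    obtain ⟨D, hD, hDe⟩ := hA.exists_measurable_shapeDet k
    refine ⟨D, hD, ?_⟩
    filter_upwards [ae_restrict_mem ((hA.measurableSet k).prod MeasurableSet.univ)] with p hp
    exact (hDe hp).symm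
  refine h1.mono_measure (Measure.restrict_mono_set μ fun p hp => ?_)
  have h2 := hAG p hp
  rw [← hA.iUnion_eq] at h2
  obtain ⟨k, hk⟩ := mem_iUnion.1 h2
  exact mem_iUnion.2 ⟨k, hk, trivial⟩

theorem IsParametrization.sFinite_localMeasure {W : Set (Euc n)} {φ : Euc n → PV n} :
    SFinite (K.localMeasure W φ) := by
  unfold localMeasure; infer_instance

/-- Change of variables over a piece of the regular double. -/
theorem IsAtlas.lintegral_piece (hA : K.IsAtlas G W φ c B) (k : ℕ) {A : Set (PV n × ℝ)}
    (hAm : MeasurableSet A) (hAB : ∀ p ∈ A, p.1 ∈ B k)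
    (hinj : InjOn (fun p : PV n × ℝ => ray p.1 p.2) A)
    (hpos : ∀ p ∈ A, 0 ≤ K.shapeDet p.1 p.2) :
    ∫⁻ p in A, ENNReal.ofReal (K.shapeDet p.1 p.2)
        ∂((K.localMeasure (W k) (φ k)).prod volume) =
      volume ((fun p : PV n × ℝ => ray p.1 p.2) '' A) := by
  obtain ⟨D, hD, hDe⟩ := hA.exists_measurable_shapeDet k
  have h := hA.param k
  have hW := h.isOpen.measurableSet
  obtain ⟨ψ, δ, hψ, hδ, hψφ, hδφ, heq⟩ := h.exists_localMeasure_eq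
  have hδ' : Measurable fun p : Euc n × ℝ => δ p.1 := hδ.comp measurable_fst
  have hψ' : Measurable (Prod.map ψ (id : ℝ → ℝ)) := hψ.prodMap measurable_id
  -- The product measure is the image under `ψ × id` of a measure with density on `W × ℝ`, which
  -- reduces the integral to the change of variables in one chart.
  have h1 : (K.localMeasure (W k) (φ k)).prod volume =
      ((((volume : Measure (Euc n)).restrict (W k)).prod (volume : Measure ℝ)).withDensity
        (fun p => δ p.1)).map (Prod.map ψ id) := by
    rw [← prod_withDensity_left hδ, ← Measure.map_prod_map _ _ hψ measurable_id, Measure.map_id,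
      heq]
  set s : Set (Euc n × ℝ) := {p | p.1 ∈ W k ∧ (φ k p.1, p.2) ∈ A} with hs
  have hs' : s = W k ×ˢ univ ∩ Prod.map ψ id ⁻¹' A := by
    ext p
    constructor
    · rintro ⟨hp, hpA⟩
      exact ⟨⟨hp, trivial⟩, by simpa [Prod.map, hψφ hp] using hpA⟩
    · rintro ⟨⟨hp, -⟩, hpA⟩
      exact ⟨hp, by simpa [Prod.map, hψφ hp] using hpA⟩
  have hsm : MeasurableSet s := hs' ▸ (hW.prod MeasurableSet.univ).inter (hψ' hAm)
  have himg : (fun p : PV n × ℝ => ray p.1 p.2) '' A =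
      (fun p : Euc n × ℝ => ray (φ k p.1) p.2) '' s := by
    ext y
    constructor
    · rintro ⟨⟨z, t⟩, hp, rfl⟩
      obtain ⟨w, hw, rfl⟩ := hA.subset k (hAB _ hp)
      exact ⟨(w, t), ⟨hw, hp⟩, rfl⟩
    · rintro ⟨p, hp, rfl⟩
      exact ⟨_, hp.2, rfl⟩
  have hinj' : InjOn (fun p : Euc n × ℝ => ray (φ k p.1) p.2) s := fun p hp q hq hpq => by
    obtain ⟨h2, h3⟩ := Prod.mk.inj (hinj hp.2 hq.2 hpq)
    exact Prod.ext (h.injOn hp.1 hq.1 h2) h3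
  have h2 : ∫⁻ p in A, ENNReal.ofReal (K.shapeDet p.1 p.2)
        ∂((K.localMeasure (W k) (φ k)).prod volume) =
      ∫⁻ p in A, ENNReal.ofReal (D p) ∂((K.localMeasure (W k) (φ k)).prod volume) :=
    setLIntegral_congr_fun hAm fun p hp => by rw [hDe ⟨hAB p hp, trivial⟩]
  rw [h2, h1, setLIntegral_map hAm hD.ennreal_ofReal hψ',
    setLIntegral_withDensity_eq_setLIntegral_mul (f := fun p => δ p.1)
      (g := fun p => ENNReal.ofReal (D (Prod.map ψ id p))) _ hδ'
      (hD.ennreal_ofReal.comp hψ') (hψ' hAm)]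
  have h3 : (((volume : Measure (Euc n)).restrict (W k)).prod (volume : Measure ℝ)).restrict
      (Prod.map ψ id ⁻¹' A) = (volume : Measure (Euc n × ℝ)).restrict s := by
    rw [hs', inter_comm, ← Measure.restrict_restrict (hψ' hAm), Measure.volume_eq_prod,
      ← Measure.prod_restrict, Measure.restrict_univ]
  rw [h3, himg, ← setLIntegral_one, h.lintegral_image_ray hsm (fun p hp => hp.1) hinj']
  refine setLIntegral_congr_fun hsm fun p hp => ?_
  have h4 : Prod.map ψ id p = (φ k p.1, p.2) := by simp [Prod.map, hψφ hp.1]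
  simp only [Pi.mul_apply, mul_one]
  rw [h4, hδφ hp.1, hDe ⟨hAB _ hp.2, trivial⟩, abs_of_nonneg (hpos _ hp.2)]

end SkeletalStructure

/-! ### Pushforward of `det (I - t S_rad) dM dt` to Lebesgue measure. -/

namespace SkeletalStructure

variable {n : ℕ} {K : SkeletalStructure n}
  {G : Set (PV n)} {W : ℕ → Set (Euc n)} {φ : ℕ → Euc n → PV n} {c : ℕ → PV n → Euc n}
  {B : ℕ → Set (PV n)}

theorem sFinite_of_eq_sum (hsum : K.skeletalMeasure =
      Measure.sum fun k => (K.localMeasure (W k) (φ k)).restrict (B k)) :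
    SFinite K.skeletalMeasure := by
  have : ∀ k, SFinite (K.localMeasure (W k) (φ k)) := fun k =>
    IsParametrization.sFinite_localMeasure
  rw [hsum]
  infer_instance

theorem IsAtlas.ae_mem (hA : K.IsAtlas G W φ c B) (hsum : K.skeletalMeasure =
      Measure.sum fun k => (K.localMeasure (W k) (φ k)).restrict (B k)) :
    ∀ᵐ z ∂K.skeletalMeasure, z ∈ G := by
  rw [hsum, Measure.ae_sum_iff]
  intro k
  filter_upwards [ae_restrict_mem (hA.measurableSet k)] with z hz
  exact hA.iUnion_eq.subset (mem_iUnion.2 ⟨k, hz⟩)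

/-- The measure `det (I - t S_rad) dM dt` corresponds to Lebesgue measure. -/
theorem IsAtlas.map_ray (hA : K.IsAtlas G W φ c B) (hsum : K.skeletalMeasure =
      Measure.sum fun k => (K.localMeasure (W k) (φ k)).restrict (B k))
    {A : Set (PV n × ℝ)} (hAm : MeasurableSet A) (hAG : ∀ p ∈ A, p.1 ∈ G)
    (hinj : InjOn (fun p : PV n × ℝ => ray p.1 p.2) A)
    (hpos : ∀ p ∈ A, 0 ≤ K.shapeDet p.1 p.2) :
    (((K.skeletalMeasure.prod volume).restrict A).withDensity
      fun p => ENNReal.ofReal (K.shapeDet p.1 p.2)).map (fun p : PV n × ℝ => ray p.1 p.2) =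
      volume.restrict ((fun p : PV n × ℝ => ray p.1 p.2) '' A) := by
  have : ∀ k, SFinite (K.localMeasure (W k) (φ k)) := fun k =>
    IsParametrization.sFinite_localMeasure
  have hray := measurable_ray (n := n)
  ext C hC
  have hBm : ∀ k, MeasurableSet (B k ×ˢ (univ : Set ℝ)) := fun k =>
    (hA.measurableSet k).prod MeasurableSet.univ
  set A' := (fun p : PV n × ℝ => ray p.1 p.2) ⁻¹' C ∩ A with hA'
  have hA'm : MeasurableSet A' := (hray hC).inter hAm
  rw [Measure.map_apply hray hC, withDensity_apply _ (hray hC),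
    Measure.restrict_restrict (hray hC), ← hA', hsum, Measure.prod_sum_left,
    Measure.restrict_sum _ hA'm, lintegral_sum_measure, Measure.restrict_apply hC]
  have h1 : ∀ k, ∫⁻ p, ENNReal.ofReal (K.shapeDet p.1 p.2)
      ∂((((K.localMeasure (W k) (φ k)).restrict (B k)).prod volume).restrict A') =
      volume ((fun p : PV n × ℝ => ray p.1 p.2) '' (A' ∩ B k ×ˢ univ)) := by
    intro k
    have h2 : (((K.localMeasure (W k) (φ k)).restrict (B k)).prod
        (volume : Measure ℝ)).restrict A' =
        ((K.localMeasure (W k) (φ k)).prod volume).restrict (A' ∩ B k ×ˢ univ) := by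
      rw [← Measure.restrict_restrict hA'm, ← Measure.prod_restrict, Measure.restrict_univ]
    rw [h2]
    exact hA.lintegral_piece k (hA'm.inter (hBm k)) (fun p hp => hp.2.1)
      (hinj.mono fun p hp => hp.1.2) fun p hp => hpos p hp.1.2
  -- The pieces of the atlas cut the image into countably many parts, disjoint by injectivity and
  -- measurable as injective images of Borel sets, so their volumes add.
  have h3 : C ∩ (fun p : PV n × ℝ => ray p.1 p.2) '' A =
      ⋃ k, (fun p : PV n × ℝ => ray p.1 p.2) '' (A' ∩ B k ×ˢ univ) := by
    rw [← image_iUnion, ← inter_iUnion, inter_comm C, ← image_inter_preimage, inter_comm A,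
      ← hA']
    congr 1
    refine (inter_eq_left.2 fun p hp => ?_).symm
    have h2 := hAG p hp.2
    rw [← hA.iUnion_eq] at h2
    obtain ⟨k, hk⟩ := mem_iUnion.1 h2
    exact mem_iUnion.2 ⟨k, hk, trivial⟩
  simp_rw [h1]
  rw [h3, measure_iUnion]
  · intro i j hij
    refine (disjoint_image_image ?_)
    rintro p hp q hq hpq
    have := hinj hp.1.2 hq.1.2 hpq
    rw [this] at hp
    exact disjoint_left.1 (hA.disjoint hij) hp.2.1 hq.2.1
  · exact fun k => (hA'm.inter (hBm k)).image_of_measurable_injOn hray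
      (hinj.mono fun p hp => hp.1.2)

end SkeletalStructure

/-! ### Null images of strata, and the time parameter of the linking flow. -/

/-- The image of a submanifold of dimension less than `d` under a map to `ℝ^d` which is
differentiable in charts is a null set. -/
theorem IsSmoothSubmanifold.volume_image_eq_zero {F : Type*} [NormedAddCommGroup F]
    [NormedSpace ℝ F] [FiniteDimensional ℝ F] {k d : ℕ} {A : Set F}
    (hA : IsSmoothSubmanifold k A) (hk : k < d) {f : F → Euc d}
    (hf : ∀ O W φ c, IsChart (k := k) A O W φ c → DifferentiableOn ℝ (fun w => f (φ w)) W) :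
    volume (f '' A) = 0 := by
  obtain ⟨O, W, φ, c, T, hT, h, hAT⟩ := hA.exists_countable_cover
  rw [hAT, image_iUnion₂, measure_biUnion_null_iff hT]
  intro x _
  rw [image_image]
  exact volume_image_eq_zero_of_finrank_lt (by simpa using hk) (hf _ _ _ _ (h x))

theorem IsSmoothSubmanifold.volume_image_ray_eq_zero {n k : ℕ} {A : Set (PV n)}
    (hA : IsSmoothSubmanifold k A) (hk : k < n) (h0 : ∀ z ∈ A, z.2 ≠ 0) :
    volume ((fun p : PV n × ℝ => ray p.1 p.2) '' (A ×ˢ univ)) = 0 := by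
  obtain ⟨O, W, φ, c, T, hT, h, hAT⟩ := hA.exists_countable_cover
  have h1 : (fun p : PV n × ℝ => ray p.1 p.2) '' (A ×ˢ univ) ⊆
      ⋃ x ∈ T, (fun p : Euc k × ℝ => ray (φ x p.1) p.2) '' (W x ×ˢ univ) := by
    rintro _ ⟨⟨z, t⟩, ⟨hz, -⟩, rfl⟩
    simp only at hz
    rw [hAT] at hz
    obtain ⟨x, hx, w, hw, rfl⟩ := mem_iUnion₂.1 hz
    exact mem_iUnion₂.2 ⟨x, hx, (w, t), ⟨hw, trivial⟩, rfl⟩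
  refine measure_mono_null h1 ((measure_biUnion_null_iff hT).2 fun x _ => ?_)
  refine volume_image_eq_zero_of_finrank_lt (by simpa using hk) ?_
  exact (SkeletalStructure.contDiffOn_ray (h x).smooth
    fun w hw => h0 _ ((h x).mapsTo hw)).differentiableOn (by simp)

/-- A flow starting at the base point which is nonsingular at time zero projects immersions to
immersions. -/
theorem NonsingularOn.immersion_fst {n k : ℕ} {f : PV n → ℝ → Euc (n + 1)} {S : Set (PV n)}
    {I : Set ℝ} (hf : NonsingularOn f S I) (h0 : 0 ∈ I) (hf0 : ∀ z ∈ S, f z 0 = z.1)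
    {O : Set (PV n)} {W : Set (Euc k)} {φ : Euc k → PV n} {c : PV n → Euc k}
    (h : IsChart S O W φ c) {w : Euc k} (hw : w ∈ W) :
    Function.Injective (fderiv ℝ (fun w => (φ w).1) w) := by
  obtain ⟨h1, h2⟩ := hf k W φ h.isOpen_source h.smooth h.mapsTo h.immersion
  have h3 : HasFDerivAt (fun p : Euc k × ℝ => f (φ p.1) p.2)
      (fderiv ℝ (fun p : Euc k × ℝ => f (φ p.1) p.2) (w, 0)) (w, 0) :=
    ((h1.contDiffAt ((h.isOpen_source.prod isOpen_univ).mem_nhds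
      ⟨hw, mem_univ _⟩)).differentiableAt (by simp)).hasFDerivAt
  have h4 := HasFDerivAt.comp (g := fun p : Euc k × ℝ => f (φ p.1) p.2)
    (f := fun w => (w, (0 : ℝ))) w h3 ((hasFDerivAt_id w).prodMk (hasFDerivAt_const (0 : ℝ) w))
  have h5 : HasFDerivAt (fun w => (φ w).1) _ w := h4.congr_of_eventuallyEq (by
    filter_upwards [h.isOpen_source.mem_nhds hw] with y hy
    exact (hf0 _ (h.mapsTo hy)).symm)
  rw [h5.fderiv]
  intro a b hab
  have h6 := h2 w hw 0 h0 (a₁ := (a, 0)) (a₂ := (b, 0)) hab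
  exact (Prod.mk.inj h6).1

/-- The witnesses solve the two affine branches of `linkingTime` for `t`. In the second case `r < s
≤ l`, so the denominator `l - r` is positive. -/
theorem exists_linkingTime {r l s : ℝ} (hr : 0 < r) (hs : 0 < s) (hsl : s ≤ l) :
    ∃ t ∈ Ioc (0 : ℝ) 1, linkingTime r l t = s := by
  rcases le_or_gt s r with h | h
  · refine ⟨s / (2 * r), ⟨by positivity, ?_⟩, ?_⟩
    · rw [div_le_one (by positivity)]; linarith
    · rw [linkingTime, if_pos (by rw [div_le_div_iff₀ (by positivity) (by norm_num)]; linarith)]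
      field_simp
  · have hlr : 0 < l - r := by linarith
    refine ⟨(s + l - 2 * r) / (2 * (l - r)), ⟨by apply div_pos <;> linarith, ?_⟩, ?_⟩
    · rw [div_le_one (by positivity)]; linarith
    · rw [linkingTime, if_neg]
      · field_simp; ring
      · rw [not_le, div_lt_div_iff₀ (by norm_num) (by positivity)]; linarith

theorem linkingTime_mem {r l t : ℝ} (hr : 0 < r) (hrl : r ≤ l) (ht : t ∈ Ioc (0 : ℝ) 1) :
    linkingTime r l t ∈ Ioc 0 l := by
  obtain ⟨h0, h1⟩ := ht
  rw [linkingTime]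
  split_ifs with h
  · exact ⟨by positivity, by nlinarith⟩
  · rw [not_le] at h
    exact ⟨by nlinarith, by nlinarith⟩

/-! ### Generic strata, and the lines filling the space. -/

namespace SkeletalLinkingStructure

variable {n m : ℕ} {Ω : Fin m → Set (Euc (n + 1))} (L : SkeletalLinkingStructure Ω)

theorem subset_double {i : Fin m} {S : Set (PV n)} (hS : S ∈ L.refinement i) :
    S ⊆ (L.skel i).double := by
  rw [← (L.isStratification i).sUnion_eq]
  exact subset_sUnion_of_mem hS

theorem ne_zero {i : Fin m} {z : PV n} (hz : z ∈ (L.skel i).double) : z.2 ≠ 0 :=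
  (L.skel i).ne_zero_of_mem_double hz

theorem radius_pos {i : Fin m} {z : PV n} (hz : z ∈ (L.skel i).double) : 0 < radius z :=
  norm_pos_iff.2 (L.ne_zero hz)

theorem radius_le_toReal {i : Fin m} {z : PV n} (hz : z ∈ (L.skel i).double)
    (hl : L.ℓ i z ≠ ⊤) : radius z ≤ (L.ℓ i z).toReal :=
  (ENNReal.ofReal_le_iff_le_toReal hl).1 (L.radius_le i z hz)

/-- The linking flow and the unlinked radial flow both start at the base point and are nonsingular
at time `0` inclusive; their derivative there along the stratum is that of the projection to `M`. -/
theorem immersion_fst {i : Fin m} {S : Set (PV n)} (hS : S ∈ L.refinement i) {k : ℕ}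
    {O : Set (PV n)} {W : Set (Euc k)} {φ : Euc k → PV n} {c : PV n → Euc k}
    (h : IsChart S O W φ c) {w : Euc k} (hw : w ∈ W) :
    Function.Injective (fderiv ℝ (fun w => (φ w).1) w) := by
  rcases L.unlinked_strata i S hS with hl | hl
  · exact (L.unlinked_nonsingular i S hS hl).immersion_fst (by simp)
      (fun z _ => by simp [radialFlow]) h hw
  · exact (L.nonsingular_inner i S hS hl).immersion_fst (by simp)
      (fun z _ => by simp [linkingFlowInner]) h hw

/-- Strata of the refinement have dimension at most `n`, and those of dimension `n` lie over the
regular part. -/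
theorem dim_le {i : Fin m} {S : Set (PV n)} (hS : S ∈ L.refinement i) {k : ℕ}
    (hk : IsSmoothSubmanifold k S) :
    k ≤ n ∧ (k = n → S ⊆ (L.skel i).regularDouble) := by
  obtain ⟨X, hX, hSX⟩ := L.refines i S hS
  obtain ⟨j, hj, hXj⟩ := (L.skel i).dim_le X hX
  obtain ⟨z, hz⟩ := ((L.isStratification i).connected S hS).nonempty
  obtain ⟨O, W, φ, c, hzO, h⟩ := hk.exists_isChart hz
  obtain ⟨w, hw, rfl⟩ := h.image_eq.superset ⟨hz, hzO⟩
  -- The stratum is immersed in `X`, so `k ≤ j ≤ n`; if `k = n`, then `X` itself has dimension `n`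
  -- and is a regular stratum.
  have hkj : k ≤ j := hXj.le_of_immersion (h.isOpen_source.mem_nhds hw)
    (h.hasFDerivAt hw).fst.differentiableAt.hasFDerivAt (fun w hw => hSX _ (h.mapsTo hw))
    (L.immersion_fst hS h hw)
  refine ⟨hkj.trans hj, fun hkn z hz => ⟨L.subset_double hS hz, X, ⟨hX, ?_⟩, hSX z hz⟩⟩
  have : j = n := le_antisymm hj (hkn ▸ hkj)
  exact this ▸ hXj

/-- The union of the `n`-dimensional strata of the refinement. -/
def generic (i : Fin m) : Set (PV n) := ⋃₀ {S ∈ L.refinement i | IsSmoothSubmanifold n S}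

theorem generic_subset (i : Fin m) : L.generic i ⊆ (L.skel i).regularDouble :=
  sUnion_subset fun _ hS => (L.dim_le hS.1 hS.2).2 rfl

theorem finite_generic (i : Fin m) :
    {S ∈ L.refinement i | IsSmoothSubmanifold n S}.Finite :=
  (L.isStratification i).finite.subset fun _ hS => hS.1

theorem exists_isAtlas (i : Fin m) :
    ∃ W φ c B, (L.skel i).IsAtlas (L.generic i) W φ c B :=
  SkeletalStructure.exists_isAtlas (L.finite_generic i).countable (fun _ hS => hS.2)
    (fun _ hS => (L.dim_le hS.1 hS.2).2 rfl) fun _ hS _ _ _ _ h _ hw => L.immersion_fst hS.1 h hw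

/-- The lines from the strata of dimension less than `n` fill a null set. -/
theorem volume_image_ray_nongeneric (i : Fin m) :
    volume ((fun p : PV n × ℝ => ray p.1 p.2) ''
      (((L.skel i).double \ L.generic i) ×ˢ univ)) = 0 := by
  have h1 : (fun p : PV n × ℝ => ray p.1 p.2) ''
      (((L.skel i).double \ L.generic i) ×ˢ univ) ⊆
      ⋃ S ∈ {S ∈ L.refinement i | ¬ IsSmoothSubmanifold n S},
        (fun p : PV n × ℝ => ray p.1 p.2) '' (S ×ˢ univ) := by
    rintro _ ⟨⟨z, t⟩, ⟨⟨hz, hzG⟩, -⟩, rfl⟩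
    simp only at hz hzG
    rw [← (L.isStratification i).sUnion_eq] at hz
    obtain ⟨S, hS, hzS⟩ := hz
    exact mem_iUnion₂.2 ⟨S, ⟨hS, fun hn => hzG ⟨S, ⟨hS, hn⟩, hzS⟩⟩, (z, t), ⟨hzS, trivial⟩, rfl⟩
  refine measure_mono_null h1 ((measure_biUnion_null_iff
    ((L.isStratification i).finite.subset fun _ hS => hS.1).countable).2 fun S hS => ?_)
  obtain ⟨k, hk⟩ := (L.isStratification i).smooth S hS.1
  have hkn : k ≠ n := fun h => hS.2 (h ▸ hk)
  exact hk.volume_image_ray_eq_zero (lt_of_le_of_ne (L.dim_le hS.1 hk).1 hkn)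
    fun z hz => L.ne_zero (L.subset_double hS.1 hz)

/-- The ends of the linking flow form a null set. -/
theorem volume_ends (i : Fin m) :
    volume ((fun z => ray z (L.ℓ i z).toReal) '' {z ∈ (L.skel i).double | L.ℓ i z ≠ ⊤}) = 0 := by
  have h1 : (fun z => ray z (L.ℓ i z).toReal) '' {z ∈ (L.skel i).double | L.ℓ i z ≠ ⊤} ⊆
      ⋃ S ∈ {S ∈ L.refinement i | ∀ z ∈ S, L.ℓ i z ≠ ⊤},
        (fun z => ray z (L.ℓ i z).toReal) '' S := by
    rintro _ ⟨z, ⟨hz, hl⟩, rfl⟩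
    rw [← (L.isStratification i).sUnion_eq] at hz
    obtain ⟨S, hS, hzS⟩ := hz
    exact mem_iUnion₂.2 ⟨S, ⟨hS, (L.unlinked_strata i S hS).resolve_left
      fun h => hl (h z hzS)⟩, z, hzS, rfl⟩
  refine measure_mono_null h1 ((measure_biUnion_null_iff
    ((L.isStratification i).finite.subset fun _ hS => hS.1).countable).2 fun S hS => ?_)
  obtain ⟨k, hk⟩ := (L.isStratification i).smooth S hS.1
  refine hk.volume_image_eq_zero (Nat.lt_succ_of_le (L.dim_le hS.1 hk).1) ?_
  intro O W φ c h
  have h2 : ContDiffOn ℝ ∞ (fun w => (L.ℓ i (φ w)).toReal) W :=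
    (L.ℓ_smooth i S hS.1 hS.2).comp h.smooth h.mapsTo
  have h3 := SkeletalStructure.contDiffOn_ray h.smooth
    fun w hw => L.ne_zero (L.subset_double hS.1 (h.mapsTo hw))
  exact (h3.comp (f := fun w => (w, (L.ℓ i (φ w)).toReal)) (contDiffOn_id.prodMk h2)
    fun w hw => ⟨hw, trivial⟩).differentiableOn (by simp)

theorem _root_.SkeletalLinking.SkeletalStructure.volume_skeletalSet (K : SkeletalStructure n) :
    volume K.M = 0 := by
  rw [← K.whitney.sUnion_eq, measure_sUnion_null_iff K.whitney.finite.countable]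
  intro X hX
  obtain ⟨k, hk, hXk⟩ := K.dim_le X hX
  have h := hXk.volume_image_eq_zero (Nat.lt_succ_of_le hk) (f := id)
    fun O W φ c h => h.smooth.differentiableOn (by simp)
  rwa [image_id] at h

/-- The interior parts of the lines from the generic points of the double. -/
def openLines (i : Fin m) : Set (PV n × ℝ) :=
  {p | p.1 ∈ L.generic i ∧ 0 < p.2 ∧ ENNReal.ofReal p.2 < L.ℓ i p.1}

/-- On each stratum `ℓ` is either constantly infinite or smooth, so it agrees there with a Borel
function; there are finitely many strata. -/
theorem measurableSet_openLines (i : Fin m) : MeasurableSet (L.openLines i) := by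
  have h1 : L.openLines i = ⋃ S ∈ {S ∈ L.refinement i | IsSmoothSubmanifold n S},
      {p : PV n × ℝ | p.1 ∈ S ∧ 0 < p.2 ∧ ENNReal.ofReal p.2 < L.ℓ i p.1} := by
    ext p
    simp only [openLines, generic, mem_sUnion, mem_iUnion₂, mem_ofPred_eq, exists_prop]
    constructor
    · rintro ⟨⟨S, hS, hp⟩, h⟩; exact ⟨S, hS, hp, h⟩
    · rintro ⟨S, hS, hp, h⟩; exact ⟨⟨S, hS, hp⟩, h⟩
  rw [h1]
  refine MeasurableSet.biUnion (L.finite_generic i).countable fun S hS => ?_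
  have hSm : MeasurableSet S := hS.2.measurableSet
  obtain ⟨g, hg, hgl⟩ : ∃ g : PV n → ℝ≥0∞, Measurable g ∧ EqOn g (L.ℓ i) S := by
    rcases L.unlinked_strata i S hS.1 with hl | hl
    · exact ⟨fun _ => ⊤, measurable_const, fun z hz => (hl z hz).symm⟩
    · obtain ⟨g, hg, hgl⟩ := exists_measurable_eqOn hSm (L.ℓ_smooth i S hS.1 hl).continuousOn
      refine ⟨fun z => ENNReal.ofReal (g z), hg.ennreal_ofReal, fun z hz => ?_⟩
      simp only
      rw [hgl hz, ENNReal.ofReal_toReal (hl z hz)]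
  have h2 : {p : PV n × ℝ | p.1 ∈ S ∧ 0 < p.2 ∧ ENNReal.ofReal p.2 < L.ℓ i p.1} =
      {p | p.1 ∈ S} ∩ ({p | 0 < p.2} ∩ {p | ENNReal.ofReal p.2 < g p.1}) := by
    ext p
    constructor
    · rintro ⟨h, h'⟩
      exact ⟨h, by rw [mem_inter_iff, mem_ofPred_eq, mem_ofPred_eq, hgl h]; exact h'⟩
    · rintro ⟨h, h'⟩
      rw [mem_inter_iff, mem_ofPred_eq, mem_ofPred_eq, hgl h] at h'
      exact ⟨h, h'⟩
  rw [h2]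
  exact (measurable_fst hSm).inter ((measurableSet_lt measurable_const measurable_snd).inter
    (measurableSet_lt measurable_snd.ennreal_ofReal (hg.comp measurable_fst)))

/-- Two unlinked lines are disjoint by `unlinked_inj`. A linked and an unlinked line cannot meet,
since the images of the two flows are complementary. Two linked lines could meet only at their ends,
which the strict inequality `t < ℓ` excludes. -/
theorem injective_ray {i j : Fin m} {p q : PV n × ℝ} (hp : p ∈ L.openLines i)
    (hq : q ∈ L.openLines j) (h : ray p.1 p.2 = ray q.1 q.2) : i = j ∧ p = q := by
  obtain ⟨z, s⟩ := p
  obtain ⟨z', s'⟩ := q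
  obtain ⟨hz, hs, hsl⟩ := hp
  obtain ⟨hz', hs', hsl'⟩ := hq
  simp only at hz hs hsl hz' hs' hsl' h
  replace hz : z ∈ (L.skel i).double := (L.generic_subset i hz).1
  replace hz' : z' ∈ (L.skel j).double := (L.generic_subset j hz').1
  have hr := L.radius_pos hz
  have hr' := L.radius_pos hz'
  by_cases hl : L.ℓ i z = ⊤ <;> by_cases hl' : L.ℓ j z' = ⊤
  · rw [ray_eq_radialFlow (L.ne_zero hz), ray_eq_radialFlow (L.ne_zero hz')] at h
    obtain ⟨h1, rfl, h2⟩ := L.unlinked_inj i j z hz z' hz' hl hl' _ _ (div_pos hs hr)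
      (div_pos hs' hr') h
    rw [div_left_inj' hr.ne'] at h2
    exact ⟨h1, by rw [h2]⟩
  · exfalso
    obtain ⟨t', ht', hst'⟩ := exists_linkingTime hr' hs'
      ((ENNReal.ofReal_lt_iff_lt_toReal hs'.le hl').1 hsl').le
    refine ((L.unlinked_image (ray z s)).1 ⟨i, z, hz, hl, s / radius z, div_pos hs hr,
      (ray_eq_radialFlow (L.ne_zero hz) s).symm⟩).2 ⟨j, z', hz', hl', t', ht', ?_⟩
    rw [h, linkingFlow, hst']; rfl
  · exfalso
    obtain ⟨t, ht, hst⟩ := exists_linkingTime hr hs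
      ((ENNReal.ofReal_lt_iff_lt_toReal hs.le hl).1 hsl).le
    refine ((L.unlinked_image (ray z' s')).1 ⟨j, z', hz', hl', s' / radius z', div_pos hs' hr',
      (ray_eq_radialFlow (L.ne_zero hz') s').symm⟩).2 ⟨i, z, hz, hl, t, ht, ?_⟩
    rw [← h, linkingFlow, hst]; rfl
  · have h1 := (ENNReal.ofReal_lt_iff_lt_toReal hs.le hl).1 hsl
    have h1' := (ENNReal.ofReal_lt_iff_lt_toReal hs'.le hl').1 hsl'
    obtain ⟨t, ht, hst⟩ := exists_linkingTime hr hs h1.le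
    obtain ⟨t', ht', hst'⟩ := exists_linkingTime hr' hs' h1'.le
    have h2 := L.linkingFlow_inj i j z hz z' hz' hl hl' t ht t' ht' (by
      rw [linkingFlow, linkingFlow, hst, hst']; exact h)
    rw [hst, hst'] at h2
    rcases h2 with ⟨h3, h4, h5⟩ | ⟨h3, -⟩
    · exact ⟨h3, by rw [h4, h5]⟩
    · exact absurd h3 h1.ne

/-- Up to a null set, the lines fill the whole space. -/
theorem ae_mem_iUnion_image_ray :
    ∀ᵐ y : Euc (n + 1), y ∈ ⋃ i, (fun p : PV n × ℝ => ray p.1 p.2) '' L.openLines i := by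
  have h1 : ∀ᵐ y : Euc (n + 1), ∀ i, y ∉ (L.skel i).M :=
    ae_all_iff.2 fun i => measure_eq_zero_iff_ae_notMem.1 (L.skel i).volume_skeletalSet
  have h2 : ∀ᵐ y : Euc (n + 1), ∀ i, y ∉ (fun z => ray z (L.ℓ i z).toReal) ''
      {z ∈ (L.skel i).double | L.ℓ i z ≠ ⊤} :=
    ae_all_iff.2 fun i => measure_eq_zero_iff_ae_notMem.1 (L.volume_ends i)
  have h3 : ∀ᵐ y : Euc (n + 1), ∀ i, y ∉ (fun p : PV n × ℝ => ray p.1 p.2) ''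
      (((L.skel i).double \ L.generic i) ×ˢ univ) :=
    ae_all_iff.2 fun i => measure_eq_zero_iff_ae_notMem.1 (L.volume_image_ray_nongeneric i)
  filter_upwards [h1, h2, h3] with y hM hE hN
  obtain ⟨i, z, hz, t, ht, htl, rfl⟩ : ∃ i, ∃ z ∈ (L.skel i).double, ∃ t : ℝ, 0 < t ∧
      ENNReal.ofReal t ≤ L.ℓ i z ∧ ray z t = y := by
    by_cases hy : ∃ i, ∃ z ∈ (L.skel i).double, L.ℓ i z ≠ ⊤ ∧
        ∃ t ∈ Ioc (0 : ℝ) 1, linkingFlow (L.ℓ i) z t = y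
    · obtain ⟨i, z, hz, hl, t, ht, rfl⟩ := hy
      have h4 := linkingTime_mem (L.radius_pos hz) (L.radius_le_toReal hz hl) ht
      exact ⟨i, z, hz, _, h4.1, (ENNReal.ofReal_le_iff_le_toReal hl).2 h4.2, rfl⟩
    · obtain ⟨i, z, hz, hl, t, ht, rfl⟩ := (L.unlinked_image y).2 ⟨hM, hy⟩
      exact ⟨i, z, hz, t * radius z, mul_pos ht (L.radius_pos hz), hl ▸ le_top,
        (radialFlow_eq_ray (L.ne_zero hz) t).symm⟩
  -- Off the three null sets, the foot point must be generic and the end `t = ℓ` is not attained.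
  refine mem_iUnion.2 ⟨i, (z, t), ⟨?_, ht, lt_of_le_of_ne htl fun h => ?_⟩, rfl⟩
  · by_contra hzG
    exact hN i ⟨(z, t), ⟨⟨hz, hzG⟩, trivial⟩, rfl⟩
  · refine hE i ⟨z, ⟨hz, h ▸ ENNReal.ofReal_ne_top⟩, ?_⟩
    simp only
    rw [← h, ENNReal.toReal_ofReal ht.le]

/-- The shape determinant is positive along the lines. -/
theorem shapeDet_pos {i : Fin m} {p : PV n × ℝ} (hp : p ∈ L.openLines i) :
    0 < (L.skel i).shapeDet p.1 p.2 := by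
  obtain ⟨z, b⟩ := p
  obtain ⟨⟨S, ⟨hS, hSn⟩, hzS⟩, hb, hbl⟩ := hp
  simp only at hzS hb hbl
  obtain ⟨O, W, φ, c, hzO, h⟩ := hSn.exists_isChart hzS
  obtain ⟨w, hw, rfl⟩ := h.image_eq.superset ⟨hzS, hzO⟩
  have hpar : (L.skel i).IsParametrization W φ :=
    ⟨h.isOpen_source, h.smooth, h.injOn, fun w hw => (L.dim_le hS hSn).2 rfl (h.mapsTo hw),
      fun w hw => L.immersion_fst hS h hw⟩
  have hr : ∀ w ∈ W, 0 < radius (φ w) := fun w hw => norm_pos_iff.2 (hpar.ne_zero hw)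
  have hrw := hr w hw
  have hrd : ∀ t, DifferentiableAt ℝ (fun p : Euc n × ℝ => radius (φ p.1)) (w, t) := fun t =>
    DifferentiableAt.comp (g := fun w => radius (φ w)) (w, t)
      (hpar.differentiableAt_radius hw) differentiableAt_fst
  refine hpar.shapeDet_pos hw hb.le fun s hs hsb => ?_
  -- Each time `s` along the line is reached by a nonsingular flow: the radial flow when unlinked,
  -- otherwise the first half of the linking flow for `s ≤ r` and the second half for `s > r`.
  rcases L.unlinked_strata i S hS with hl | hl
  · have h1 := hpar.shapeDet_ne_zero hw (L.unlinked_nonsingular i S hS hl) h.mapsTo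
      (χ := fun p => p.2 * radius (φ p.1)) (t := s / radius (φ w)) (div_pos hs hrw).le
      (differentiableAt_snd.mul (hrd _))
      (fun w hw t => radialFlow_eq_ray (hpar.ne_zero hw) t)
    simpa [hrw.ne'] using h1
  · rcases le_or_gt s (radius (φ w)) with hsr | hsr
    · have h1 := hpar.shapeDet_ne_zero hw (L.nonsingular_inner i S hS hl) h.mapsTo
        (χ := fun p => 2 * p.2 * radius (φ p.1)) (t := s / (2 * radius (φ w)))
        ⟨by positivity, by rw [div_le_div_iff₀ (by positivity) (by norm_num)]; linarith⟩
        ((differentiableAt_snd.const_mul 2).mul (hrd _)) (fun w hw t => rfl)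
      have h2 : 2 * (s / (2 * radius (φ w))) * radius (φ w) = s := by field_simp
      simpa only [h2] using h1
    · have hbl' := (ENNReal.ofReal_lt_iff_lt_toReal hb.le (hl _ hzS)).1 hbl
      rcases L.nonsingular_outer i S hS hl with ⟨-, ho⟩ | ⟨-, ho⟩
      · have hld : DifferentiableAt ℝ (fun w => (L.ℓ i (φ w)).toReal) w :=
          (((L.ℓ_smooth i S hS hl).comp h.smooth h.mapsTo).contDiffAt
            (h.isOpen_source.mem_nhds hw)).differentiableAt (by simp)
        set l := (L.ℓ i (φ w)).toReal with hl_def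
        have hlr : 0 < l - radius (φ w) := by linarith
        have hld' : ∀ t, DifferentiableAt ℝ (fun p : Euc n × ℝ => (L.ℓ i (φ p.1)).toReal) (w, t) :=
          fun t => DifferentiableAt.comp (g := fun w => (L.ℓ i (φ w)).toReal) (w, t) hld
            differentiableAt_fst
        have h1 := hpar.shapeDet_ne_zero hw ho h.mapsTo
          (χ := fun p => 2 * (1 - p.2) * radius (φ p.1) +
            (2 * p.2 - 1) * (L.ℓ i (φ p.1)).toReal)
          (t := (s + l - 2 * radius (φ w)) / (2 * (l - radius (φ w))))
          ⟨by rw [div_le_div_iff₀ (by norm_num) (by positivity)]; linarith,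
            by rw [div_le_one (by positivity)]; linarith⟩
          ((((differentiableAt_snd.const_sub 1).const_mul 2).mul (hrd _)).add
            (((differentiableAt_snd.const_mul 2).sub_const 1).mul (hld' _)))
          (fun w hw t => rfl)
        have h2 : 2 * (1 - (s + l - 2 * radius (φ w)) / (2 * (l - radius (φ w)))) *
            radius (φ w) + (2 * ((s + l - 2 * radius (φ w)) / (2 * (l - radius (φ w)))) - 1) *
              l = s := by
          field_simp; ring
        simp only [← hl_def] at h1
        rwa [h2] at h1
      -- When the second half is constant, `ℓ = r`, so the line has no points with `s > r`.
      · exfalso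
        rw [ho _ hzS, ENNReal.toReal_ofReal hrw.le] at hbl'
        linarith

end SkeletalLinkingStructure

theorem ae_eq_set_of_finite {s t F : Set ℝ} (hF : F.Finite) (h : ∀ x ∉ F, (x ∈ s ↔ x ∈ t)) :
    s =ᵐ[volume] t := by
  refine eventuallyEq_set.2 ?_
  filter_upwards [measure_eq_zero_iff_ae_notMem.1 (hF.measure_zero volume)] with x hx
  exact h x hx

/-! ### Integration along the lines. -/

namespace SkeletalLinkingStructure

variable {n m : ℕ} {Ω : Fin m → Set (Euc (n + 1))} (L : SkeletalLinkingStructure Ω)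

theorem volume_image_ray_regular_diff_generic (i : Fin m) :
    volume ((fun p : PV n × ℝ => ray p.1 p.2) ''
      (((L.skel i).regularDouble \ L.generic i) ×ˢ univ)) = 0 :=
  measure_mono_null (image_mono (prod_mono (sdiff_subset_sdiff_left fun _ hz => hz.1) le_rfl))
    (L.volume_image_ray_nongeneric i)

/-- A supremum of measures carries no finiteness by itself; the countable sum supplies the
s-finiteness that Fubini requires. -/
instance sFinite_dM (i : Fin m) : SFinite (L.dM i) := by
  obtain ⟨W, φ, c, B, hA⟩ := L.exists_isAtlas i
  exact SkeletalStructure.sFinite_of_eq_sum (hA.skeletalMeasure_eq_sum (L.isSkeletal i)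
    (L.volume_image_ray_regular_diff_generic i))

theorem ae_mem_generic (i : Fin m) : ∀ᵐ z ∂(L.dM i), z ∈ L.generic i := by
  obtain ⟨W, φ, c, B, hA⟩ := L.exists_isAtlas i
  exact hA.ae_mem (hA.skeletalMeasure_eq_sum (L.isSkeletal i)
    (L.volume_image_ray_regular_diff_generic i))

theorem injOn_ray (i : Fin m) :
    InjOn (fun p : PV n × ℝ => ray p.1 p.2) (L.openLines i) := fun _ hp _ hq h =>
  (L.injective_ray hp hq h).2

/-- Change of variables along the lines from one double. -/
theorem integral_image_ray (i : Fin m) {g : Euc (n + 1) → ℝ} (hg : Measurable g)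
    (hgi : Integrable g) :
    IntegrableOn (fun p : PV n × ℝ => L.lineIntegrand i g p.1 p.2) (L.openLines i)
        ((L.dM i).prod volume) ∧
      ∫ p in L.openLines i, L.lineIntegrand i g p.1 p.2 ∂((L.dM i).prod volume) =
        ∫ y in (fun p : PV n × ℝ => ray p.1 p.2) '' L.openLines i, g y := by
  obtain ⟨W, φ, c, B, hA⟩ := L.exists_isAtlas i
  have hsum := hA.skeletalMeasure_eq_sum (L.isSkeletal i)
    (L.volume_image_ray_regular_diff_generic i)
  have hm := L.measurableSet_openLines i
  have hmap := hA.map_ray hsum hm (fun p hp => hp.1) (L.injOn_ray i)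
    fun p hp => (L.shapeDet_pos hp).le
  have hD := (hA.aemeasurable_shapeDet ((L.dM i).prod volume) (A := L.openLines i)
    fun p hp => hp.1).ennreal_ofReal
  have hcongr : (fun p : PV n × ℝ => (ENNReal.ofReal ((L.skel i).shapeDet p.1 p.2)).toReal •
      g (ray p.1 p.2)) =ᵐ[((L.dM i).prod volume).restrict (L.openLines i)]
      fun p => L.lineIntegrand i g p.1 p.2 := by
    filter_upwards [ae_restrict_mem hm] with p hp
    rw [ENNReal.toReal_ofReal (L.shapeDet_pos hp).le, smul_eq_mul, mul_comm]
    rfl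
  have htop : ∀ᵐ p ∂(((L.dM i).prod volume).restrict (L.openLines i)),
      ENNReal.ofReal ((L.skel i).shapeDet p.1 p.2) < ⊤ :=
    Eventually.of_forall fun p => ENNReal.ofReal_lt_top
  constructor
  · have h1 : Integrable g (volume.restrict
        ((fun p : PV n × ℝ => ray p.1 p.2) '' L.openLines i)) := hgi.integrableOn
    rw [← hmap, integrable_map_measure hg.aestronglyMeasurable measurable_ray.aemeasurable] at h1
    exact ((integrable_withDensity_iff_integrable_smul₀' hD htop).1 h1).congr hcongr
  · rw [← hmap, integral_map measurable_ray.aemeasurable hg.aestronglyMeasurable]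
    exact ((integral_withDensity_eq_integral_toReal_smul₀ hD htop _).trans
      (integral_congr_ae hcongr)).symm

/-- Fubini's theorem on a part of the lines from one double. -/
theorem integral_lines (i : Fin m) {g : Euc (n + 1) → ℝ} (hg : Measurable g)
    (hgi : Integrable g) {A : Set (PV n × ℝ)} (hA : MeasurableSet A) (hAL : A ⊆ L.openLines i)
    {a : PV n → ℝ} {b : PV n → ℝ≥0∞}
    (hab : ∀ z ∈ L.generic i, Prod.mk z ⁻¹' A =ᵐ[volume] interval (a z) (b z)) :
    (∀ᵐ z ∂(L.dM i), IntegrableOn (L.lineIntegrand i g z) (interval (a z) (b z))) ∧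
      Integrable (fun z => ∫ t in interval (a z) (b z), L.lineIntegrand i g z t) (L.dM i) ∧
      ∫ z, (∫ t in interval (a z) (b z), L.lineIntegrand i g z t) ∂(L.dM i) =
        ∫ p in A, L.lineIntegrand i g p.1 p.2 ∂((L.dM i).prod volume) := by
  have h1 : Integrable (A.indicator fun p : PV n × ℝ => L.lineIntegrand i g p.1 p.2)
      ((L.dM i).prod volume) :=
    ((L.integral_image_ray i hg hgi).1.mono_set hAL).integrable_indicator hA
  have hm : ∀ z : PV n, MeasurableSet (Prod.mk z ⁻¹' A) := fun z => measurable_prodMk_left hA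
  have h2 : ∀ z t, A.indicator (fun p : PV n × ℝ => L.lineIntegrand i g p.1 p.2) (z, t) =
      (Prod.mk z ⁻¹' A).indicator (L.lineIntegrand i g z) t := fun z t => rfl
  have h3 : (fun z => ∫ t, A.indicator (fun p : PV n × ℝ => L.lineIntegrand i g p.1 p.2) (z, t))
      =ᵐ[L.dM i] fun z => ∫ t in interval (a z) (b z), L.lineIntegrand i g z t := by
    filter_upwards [L.ae_mem_generic i] with z hz
    simp_rw [h2]
    rw [integral_indicator (hm z)]
    exact setIntegral_congr_set (hab z hz)
  refine ⟨?_, h1.integral_prod_left.congr h3, ?_⟩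
  · filter_upwards [h1.prod_right_ae, L.ae_mem_generic i] with z hz hzG
    simp_rw [h2] at hz
    exact ((integrable_indicator_iff (hm z)).1 hz).congr_set_ae (hab z hzG).symm
  · rw [← integral_indicator hA, integral_prod _ h1]
    exact (integral_congr_ae h3).symm

theorem measurable_radius : Measurable fun p : PV n × ℝ => radius p.1 :=
  measurable_fst.snd.norm

/-- The lines inside the regions. -/
theorem openLines_inner_ae {i : Fin m} {z : PV n} (hz : z ∈ L.generic i) :
    Prod.mk z ⁻¹' (L.openLines i ∩ {p | p.2 ≤ radius p.1}) =ᵐ[volume]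
      interval 0 (ENNReal.ofReal (radius z)) := by
  refine ae_eq_set_of_finite (F := {0, radius z}) (by simp) fun t ht => ?_
  simp only [mem_insert_iff, mem_singleton_iff, not_or] at ht
  have hzd := (L.generic_subset i hz).1
  constructor
  · rintro ⟨⟨-, h0, -⟩, hr⟩
    exact ⟨h0.le, ENNReal.ofReal_le_ofReal hr⟩
  · rintro ⟨h0, hr⟩
    rw [ENNReal.ofReal_le_ofReal_iff (L.radius_pos hzd).le] at hr
    exact ⟨⟨hz, lt_of_le_of_ne h0 (Ne.symm ht.1),
      (ENNReal.ofReal_lt_ofReal_iff (L.radius_pos hzd)).2 (lt_of_le_of_ne hr ht.2)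
        |>.trans_le (L.radius_le i z hzd)⟩, hr⟩

/-- The whole lines. -/
theorem openLines_ae {i : Fin m} {z : PV n} (hz : z ∈ L.generic i) :
    Prod.mk z ⁻¹' L.openLines i =ᵐ[volume] interval 0 (L.ℓ i z) := by
  -- Only the endpoints can differ. For `ℓ = ⊤` the second point is `0` by convention, which is
  -- harmless.
  refine ae_eq_set_of_finite (F := {0, (L.ℓ i z).toReal}) (by simp) fun t ht => ?_
  simp only [mem_insert_iff, mem_singleton_iff, not_or] at ht
  constructor
  · rintro ⟨-, h0, hl⟩
    exact ⟨h0.le, hl.le⟩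
  · rintro ⟨h0, hl⟩
    exact ⟨hz, lt_of_le_of_ne h0 (Ne.symm ht.1), lt_of_le_of_ne hl fun h =>
      ht.2 (by rw [← h, ENNReal.toReal_ofReal h0])⟩

/-- The lines outside the regions. -/
theorem openLines_outer_ae {i : Fin m} {z : PV n} (hz : z ∈ L.generic i) :
    Prod.mk z ⁻¹' (L.openLines i \ {p | p.2 ≤ radius p.1}) =ᵐ[volume]
      interval (radius z) (L.ℓ i z) := by
  refine ae_eq_set_of_finite (F := {radius z, (L.ℓ i z).toReal}) (by simp) fun t ht => ?_
  simp only [mem_insert_iff, mem_singleton_iff, not_or] at ht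
  have hr := L.radius_pos (L.generic_subset i hz).1
  constructor
  · rintro ⟨⟨-, -, hl⟩, h0⟩
    exact ⟨(not_le.1 h0).le, hl.le⟩
  · rintro ⟨h0, hl⟩
    exact ⟨⟨hz, hr.trans_le h0, lt_of_le_of_ne hl fun h =>
      ht.2 (by rw [← h, ENNReal.toReal_ofReal (hr.le.trans h0)])⟩,
      not_le.2 (lt_of_le_of_ne h0 (Ne.symm ht.1))⟩

/-- The images of the open lines of the different regions are disjoint and together have full
measure. -/
theorem integral_eq_sum {g : Euc (n + 1) → ℝ} (hg : Measurable g) (hgi : Integrable g) :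
    ∫ y, g y =
      ∑ i, ∫ p in L.openLines i, L.lineIntegrand i g p.1 p.2 ∂((L.dM i).prod volume) := by
  simp_rw [fun i => (L.integral_image_ray i hg hgi).2]
  rw [← integral_iUnion_fintype
    (fun i => (L.measurableSet_openLines i).image_of_measurable_injOn measurable_ray
      (L.injOn_ray i)) ?_ fun i => hgi.integrableOn,
    Measure.restrict_eq_self_of_ae_mem L.ae_mem_iUnion_image_ray]
  intro i j hij
  refine disjoint_image_image fun p hp q hq h => hij (L.injective_ray hp hq h).1

theorem lineIntegrable_and_integral {g : Euc (n + 1) → ℝ} (hg : Measurable g)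
    (hgi : Integrable g) :
    L.LineIntegrable g (fun _ => 0) L.ℓ ∧ ∫ y, g y = L.integral (L.gTilde g) := by
  have h := fun i => L.integral_lines i hg hgi (L.measurableSet_openLines i) subset_rfl
    fun z hz => L.openLines_ae hz
  refine ⟨fun i => ⟨(h i).1, (h i).2.1⟩, ?_⟩
  rw [L.integral_eq_sum hg hgi]
  exact Finset.sum_congr rfl fun i _ => (h i).2.2.symm

theorem lineIntegrable_and_integral_decomposition {g : Euc (n + 1) → ℝ} (hg : Measurable g)
    (hgi : Integrable g) :
    L.LineIntegrable g (fun _ => 0) (fun _ z => ENNReal.ofReal (radius z)) ∧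
      L.LineIntegrable g radius L.ℓ ∧
      ∫ y, g y = L.integral (L.gInt g) + L.integral (L.gExt g) := by
  have hm : MeasurableSet {p : PV n × ℝ | p.2 ≤ radius p.1} :=
    measurableSet_le measurable_snd measurable_radius
  have hint := fun i => L.integral_lines i hg hgi ((L.measurableSet_openLines i).inter hm)
    inter_subset_left fun z hz => L.openLines_inner_ae hz
  have hext := fun i => L.integral_lines i hg hgi ((L.measurableSet_openLines i).diff hm)
    sdiff_subset fun z hz => L.openLines_outer_ae hz
  refine ⟨fun i => ⟨(hint i).1, (hint i).2.1⟩, fun i => ⟨(hext i).1, (hext i).2.1⟩, ?_⟩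
  rw [L.integral_eq_sum hg hgi, integral, integral, ← Finset.sum_add_distrib]
  refine Finset.sum_congr rfl fun i _ => ?_
  -- The integral over the open lines is cut at `t = r` before Fubini is applied to each part.
  rw [← integral_inter_add_sdiff hm (L.integral_image_ray i hg hgi).1]
  exact congrArg₂ (· + ·) (hint i).2.2.symm (hext i).2.2.symm

end SkeletalLinkingStructure

end SkeletalLinking

theorem mainTheorem11 (n m : ℕ) (Ω : Fin m → Set (EuclideanSpace ℝ (Fin (n + 1))))
    (hΩ : SkeletalLinking.IsMultiRegionConfiguration Ω)
    (L : SkeletalLinking.SkeletalLinkingStructure Ω) :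
    (∀ g : EuclideanSpace ℝ (Fin (n + 1)) → ℝ,
      Measurable g → Integrable g volume → HasCompactSupport g →
      (L.LineIntegrable g (fun _ => 0) L.ℓ ∧
        ∫ y, g y = L.integral (L.gTilde g)) ∧
      (L.LineIntegrable g (fun _ => 0) (fun _ z => ENNReal.ofReal (SkeletalLinking.radius z)) ∧
        L.LineIntegrable g SkeletalLinking.radius L.ℓ ∧
        ∫ y, g y = L.integral (L.gInt g) + L.integral (L.gExt g))) ∧
    (∀ Q : Set (EuclideanSpace ℝ (Fin (n + 1))), IsCompact Q →
      L.LineIntegrable (Q.indicator (fun _ => 1)) (fun _ => 0) L.ℓ ∧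
      (volume Q).toReal = L.integral (L.crofton Q)) := by
  refine ⟨fun g hg hgi _ => ⟨L.lineIntegrable_and_integral hg hgi,
    L.lineIntegrable_and_integral_decomposition hg hgi⟩, fun Q hQ => ?_⟩
  -- The Crofton formula is the first formula for the indicator of `Q`, integrable because compact
  -- sets have finite volume.
  have h := L.lineIntegrable_and_integral
    (measurable_const.indicator hQ.measurableSet : Measurable (Q.indicator fun _ => (1 : ℝ)))
    ((integrable_indicator_iff hQ.measurableSet).2
      (integrableOn_const hQ.measure_lt_top.ne))
  refine ⟨h.1, ?_⟩
  have h2 := h.2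
  rw [integral_indicator hQ.measurableSet, setIntegral_const, smul_eq_mul, mul_one] at h2
  exact h2
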